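/- Let $X$ be a smooth complete irreducible curve over an algebraically closed field of characteristic zero, with canonical divisor $K_X$. For a divisor $D$ on $X$ write $|D|$ for its complete linear system, $h^0(D)=h^0(X,\mathcal O_X(D))$, and $\dim|D|=h^0(D)-1$; for effective divisors $D,E$ let $(D,E)$ denote their greatest common divisor. A line bundle $\mathcal L$ on $X$ is nonspecial if $h^1(X,\mathcal L)=0$. A presentation of a nonspecial line bundle $\mathcal L$ is an isomorphism $\mathcal L\simeq\mathcal O_X(K_X-A+E)$ with effective divisors $A$ and $E>0$ such that $h^0(A)=1$ and $(A,E)=0$; it is minimal if $\deg F\ge\deg E$ for every presentation $\mathcal L\simeq\mathcal O_X(K_X-B+F)$. Let $g^r_d=|D_0|$ be a complete linear system on $X$ of degree $d$ and dimension $r\ge 0$, let $\xi$ be an effective divisor of degree $e$ with $h^0(\xi)=1$, and suppose that the line bundle $\mathcal L\simeq\mathcal O_X(K_X-D_0+\xi)$ is nonspecial. Set $$\beta:=\max\{\deg(\xi,D)\mid D\in g^r_d\},$$ and assume that $\dim|D_0+G|=r$ for every effective divisor $G\ge 0$ with $\deg G\le e-\beta-1$. If $D\in g^r_d$ satisfies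 $\deg(\xi,D)=\beta$, then $$\mathcal L\simeq\mathcal O_X\bigl(K_X-(D-(\xi,D))+(\xi-(\xi,D))\bigr)$$ is a minimal presentation of $\mathcal L$; here $D-(\xi,D)$ and $\xi-(\xi,D)$ are effective divisors of degrees $d-\beta$ and $e-\beta$, each with $h^0=1$. -/

import Mathlib

open AlgebraicGeometry CategoryTheory TopologicalSpace KaehlerDifferential TensorProduct

universe u

set_option linter.style.haveILetI false

/-- The local ring at a maximal ideal of a domain that is smooth of relative dimension one over an
algebraically closed field is a discrete valuation ring. -/
theorem isDVR_of_smooth {k A R : Type u} [Field k] [IsAlgClosed k] [CommRing A] [IsDomain A]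
    [Algebra k A] [Algebra.IsStandardSmoothOfRelativeDimension 1 k A] (m : Ideal A)
    [hm : m.IsMaximal] [CommRing R] [IsDomain R] [Algebra A R] [IsLocalization.AtPrime R m] :
    IsDiscreteValuationRing R := by
  letI : Algebra k R := ((algebraMap A R).comp (algebraMap k A)).toAlgebra
  haveI : IsScalarTower k A R := IsScalarTower.of_algebraMap_eq' rfl
  haveI := IsLocalization.AtPrime.isLocalRing R m
  haveI := Algebra.IsStandardSmoothOfRelativeDimension.isStandardSmooth (R := k) (S := A) 1
  haveI : Algebra.FiniteType k A := inferInstance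
  haveI : IsNoetherianRing A := Algebra.FiniteType.isNoetherianRing k A
  haveI : IsNoetherianRing R := IsLocalization.isNoetherianRing m.primeCompl R inferInstance
  haveI : Algebra.FormallySmooth k A := inferInstance
  haveI : Algebra.FormallySmooth A R := Algebra.FormallySmooth.of_isLocalization m.primeCompl
  haveI : Algebra.FormallySmooth k R := Algebra.FormallySmooth.comp k A R
  -- the residue field is `k`
  let κ := IsLocalRing.ResidueField R
  have hAκ : Function.Surjective (algebraMap A κ) := by
    intro y
    obtain ⟨x, rfl⟩ := IsLocalRing.residue_surjective y
    obtain ⟨z, hz⟩ := (IsLocalization.AtPrime.equivQuotMaximalIdeal m R).surjective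
      (Ideal.Quotient.mk _ x)
    obtain ⟨a, rfl⟩ := Ideal.Quotient.mk_surjective z
    refine ⟨a, ?_⟩
    have h2 : algebraMap A (R ⧸ IsLocalRing.maximalIdeal R) a =
        Ideal.Quotient.mk (IsLocalRing.maximalIdeal R) x := by simpa using hz
    exact h2
  haveI : Algebra.FiniteType k κ :=
    Algebra.FiniteType.of_surjective (IsScalarTower.toAlgHom k A κ) hAκ
  haveI : Module.Finite k κ := finite_of_finite_type_of_isJacobsonRing k κ
  have hbij : Function.Bijective (algebraMap k κ) := IsAlgClosed.algebraMap_bijective_of_isIntegral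
  haveI : Algebra.FormallyEtale k κ :=
    Algebra.FormallyEtale.of_equiv (AlgEquiv.ofBijective (Algebra.ofId k κ) hbij)
  have hk : RingHom.ker (algebraMap R κ) = IsLocalRing.maximalIdeal R := IsLocalRing.ker_residue
  obtain ⟨f, hf⟩ : ∃ f : (IsLocalRing.maximalIdeal R).Cotangent →ₗ[R] κ ⊗[R] Ω[R⁄k],
      Function.Bijective f := by
    rw [← hk]
    refine ⟨KaehlerDifferential.kerCotangentToTensor k R κ, ?_, ?_⟩
    · rw [Algebra.FormallySmooth.kerCotangentToTensor_injective_iff IsLocalRing.residue_surjective]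
      infer_instance
    · rw [← LinearMap.range_eq_top,
        KaehlerDifferential.range_kerCotangentToTensor k R κ IsLocalRing.residue_surjective]
      ext x
      simp [Subsingleton.elim _ (0 : Ω[κ⁄k])]
  -- the cotangent space has dimension one
  have hrank : Module.finrank R Ω[R⁄k] = 1 := by
    have h1 := IsLocalizedModule.finrank_eq m.primeCompl (KaehlerDifferential.map k k A R)
      m.primeCompl_le_nonZeroDivisors
    have h2 : Module.finrank R Ω[R⁄k] = Module.finrank A Ω[R⁄k] :=
      IsLocalization.finrank_eq R m.primeCompl m.primeCompl_le_nonZeroDivisors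
    rw [h2, h1, Module.finrank,
      Algebra.IsStandardSmoothOfRelativeDimension.rank_kaehlerDifferential (R := k) (S := A) 1]
    simp
  haveI : Module.Free R Ω[R⁄k] := by
    exact Module.free_of_isLocalizedModule m.primeCompl (KaehlerDifferential.map k k A R)
  rw [← IsLocalRing.finrank_CotangentSpace_eq_one_iff]
  have e := LinearEquiv.finrank_eq ((LinearEquiv.ofBijective f hf).extendScalarsOfSurjective
    (S := κ) IsLocalRing.residue_surjective)
  rw [Module.finrank_baseChange, hrank] at e
  exact e

/-- A smooth (complete, irreducible, reduced) curve over `k`: an integral scheme, proper and smooth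
of relative dimension one over `Spec k`. -/
structure SmoothCurve (k : Type u) [Field k] where
  X : Scheme.{u}
  π : X ⟶ Spec (.of k)
  [integral : IsIntegral X]
  [proper : IsProper π]
  [smooth : SmoothOfRelativeDimension 1 π]

namespace SmoothCurve
variable {k : Type u} [Field k] (C : SmoothCurve k)
attribute [instance] SmoothCurve.integral SmoothCurve.proper SmoothCurve.smooth

instance isLocallyNoetherian : IsLocallyNoetherian C.X :=
  LocallyOfFiniteType.isLocallyNoetherian C.π

/-- The points of the curve in the classical sense, i.e. the closed points of the scheme. -/
abbrev Point : Type u := {x : C.X // IsClosed ({x} : Set C.X)}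

theorem isDVR_stalk [IsAlgClosed k] (P : C.Point) :
    IsDiscreteValuationRing (C.X.presheaf.stalk P.1) := by
  obtain ⟨U, hU, V, hV, hxV, e, h⟩ :=
    SmoothOfRelativeDimension.exists_isStandardSmoothOfRelativeDimension (n := 1) (f := C.π) P.1
  have hUtop : U = ⊤ := by
    ext y
    have hy : C.π P.1 ∈ U := e hxV
    have : y = C.π P.1 := Subsingleton.elim (α := PrimeSpectrum k) _ _
    simp [this, hy]
  subst hUtop
  have : Nonempty V := ⟨⟨_, hxV⟩⟩
  let φ : k →+* Γ(C.X, V) := (C.π.appLE ⊤ V e).hom.comp (Scheme.ΓSpecIso (.of k)).inv.hom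
  have hφ : φ.IsStandardSmoothOfRelativeDimension 1 :=
    RingHom.isStandardSmoothOfRelativeDimension_respectsIso.2 _
      (Scheme.ΓSpecIso (.of k)).symm.commRingCatIsoToRingEquiv h
  letI := φ.toAlgebra
  haveI : Algebra.IsStandardSmoothOfRelativeDimension 1 k Γ(C.X, V) := hφ
  letI := TopCat.Presheaf.algebra_section_stalk C.X.presheaf (⟨P.1, hxV⟩ : V)
  haveI := hV.isLocalization_stalk ⟨P.1, hxV⟩
  haveI := hV.primeIdealOf_isMaximal_of_isClosed ⟨P.1, hxV⟩ P.2
  exact isDVR_of_smooth (k := k) (A := Γ(C.X, V)) (hV.primeIdealOf ⟨P.1, hxV⟩).asIdeal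

theorem coheight_point [IsAlgClosed k] (P : C.Point) : Order.coheight P.1 = 1 := by
  have := C.isDVR_stalk P
  have h := ringKrullDim_stalk_eq_coheight P.1
  rw [IsDiscreteValuationRing.ringKrullDim_eq_one] at h
  exact_mod_cast h.symm

/-- The field of rational functions on the curve. -/
abbrev FunctionField : Type u := C.X.functionField

instance nonempty_top : Nonempty (⊤ : C.X.Opens) := ⟨⟨genericPoint C.X, trivial⟩⟩

/-- Constants are rational functions, through the structure morphism of the curve. -/
noncomputable instance algebraFunctionField : Algebra k C.FunctionField :=
  RingHom.toAlgebra ((C.X.germToFunctionField ⊤).hom.comp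
    (C.π.appTop.hom.comp (Scheme.ΓSpecIso (.of k)).inv.hom))

/-- The order of vanishing of a rational function at a point; the value at the zero function is the
junk value `0`, so it is only used for nonzero functions. -/
noncomputable def ord (P : C.Point) (f : C.FunctionField) : ℤ := C.X.ord f P.1

theorem ord_mul (P : C.Point) {f g : C.FunctionField} (hf : f ≠ 0) (hg : g ≠ 0) :
    C.ord P (f * g) = C.ord P f + C.ord P g := by
  exact Scheme.ord_mul hf hg

theorem ord_algebraMap (P : C.Point) {c : k} (hc : c ≠ 0) :
    C.ord P (algebraMap k C.FunctionField c) = 0 :=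
  Scheme.ord_of_isUnit (U := ⊤) (f := (C.π.appTop.hom.comp (Scheme.ΓSpecIso (.of k)).inv.hom) c)
    ((IsUnit.mk0 c hc).map _) trivial

theorem min_ord_le_ord_add [IsAlgClosed k] (P : C.Point) {f g : C.FunctionField}
    (h : f + g ≠ 0) : min (C.ord P f) (C.ord P g) ≤ C.ord P (f + g) := by
  have := C.isDVR_stalk P
  exact Scheme.ord_add h

theorem ord_neg (P : C.Point) (f : C.FunctionField) : C.ord P (-f) = C.ord P f := by
  by_cases hf : f = 0
  · simp [hf]
  have h := C.ord_algebraMap P (c := -1) (by simp)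
  have := C.ord_mul P (f := algebraMap k C.FunctionField (-1)) (g := f) (by simp) hf
  rw [h] at this
  simpa using this

/-- Divisors: formal finite `ℤ`-linear combinations of points. `D ≤ E` is the coefficientwise order,
and for effective divisors `D ⊓ E` (the coefficientwise minimum) is the greatest common divisor.
A divisor `D` also stands for the line bundle `O(D)`: on a smooth curve every line bundle is
isomorphic to some `O(D)`, and `O(D) ≅ O(E)` if and only if `D` and `E` are linearly equivalent. -/
abbrev Divisor : Type u := C.Point →₀ ℤ

variable {C}

/-- The degree of a divisor (all residue fields are `k`). -/
def Divisor.deg (D : C.Divisor) : ℤ := D.sum fun _ n => n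

/-- Linear equivalence: `D - E` is the divisor of a nonzero rational function. -/
def Divisor.LinEquiv (D E : C.Divisor) : Prop :=
  ∃ f : C.FunctionField, f ≠ 0 ∧ ∀ P : C.Point, D P - E P = C.ord P f

/-- The condition `ord_P f + D(P) ≥ 0`: the rational function `f` lies in the stalk of `O(D)` at
`P`. -/
def Divisor.HasPolesLE (D : C.Divisor) (P : C.Point) (f : C.FunctionField) : Prop :=
  f = 0 ∨ - D P ≤ C.ord P f

namespace Divisor
section
variable {D : C.Divisor} {P : C.Point} {f g : C.FunctionField}

theorem HasPolesLE.zero : D.HasPolesLE P 0 := Or.inl rfl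

theorem HasPolesLE.add [IsAlgClosed k] (hf : D.HasPolesLE P f) (hg : D.HasPolesLE P g) :
    D.HasPolesLE P (f + g) := by
  rcases hf with rfl | hf
  · simpa using hg
  rcases hg with rfl | hg
  · rw [add_zero]
    exact Or.inr hf
  by_cases h : f + g = 0
  · exact Or.inl h
  · exact Or.inr ((le_min hf hg).trans (C.min_ord_le_ord_add P h))

theorem HasPolesLE.neg (hf : D.HasPolesLE P f) : D.HasPolesLE P (-f) := by
  rcases hf with rfl | hf
  · simpa using HasPolesLE.zero
  · exact Or.inr (by rwa [C.ord_neg])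

theorem HasPolesLE.smul (c : k) (hf : D.HasPolesLE P f) : D.HasPolesLE P (c • f) := by
  rcases eq_or_ne c 0 with rfl | hc
  · simpa using HasPolesLE.zero
  rcases eq_or_ne f 0 with rfl | hf0
  · simpa using HasPolesLE.zero
  rcases hf with rfl | hf
  · simpa using HasPolesLE.zero
  · refine Or.inr ?_
    rw [Algebra.smul_def, C.ord_mul P (by simpa using hc) hf0, C.ord_algebraMap P hc]
    simpa using hf
end
variable [IsAlgClosed k]

/-- The space `H⁰(X, O(D))` of rational functions `f` with `f = 0` or `div f + D ≥ 0`. -/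
def globalSections (D : C.Divisor) : Submodule k C.FunctionField where
  carrier := {f | ∀ P : C.Point, D.HasPolesLE P f}
  zero_mem' _ := HasPolesLE.zero
  add_mem' hf hg P := (hf P).add (hg P)
  smul_mem' c _ hf P := (hf P).smul c

/-- `h⁰(X, O(D))`. -/
noncomputable def h0 (D : C.Divisor) : ℕ := Module.finrank k D.globalSections

/-- The sections over `U` of the sheaf `O(D)`: locally constant functions `s` on `U` with values in
the function field (on the irreducible space `X` this means one rational function if `U` is
nonempty, and only the zero section if `U` is empty), such that `ord_P s + D(P) ≥ 0` at all points
`P` of `U`. -/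
def sections (D : C.Divisor) (U : Opens C.X) : AddSubgroup (U → C.FunctionField) where
  carrier := {s | IsLocallyConstant s ∧ ∀ (P : C.Point) (hP : P.1 ∈ U), D.HasPolesLE P (s ⟨P.1, hP⟩)}
  zero_mem' := ⟨IsLocallyConstant.const 0, fun _ _ => HasPolesLE.zero⟩
  add_mem' hs ht := ⟨hs.1.add ht.1, fun P hP => (hs.2 P hP).add (ht.2 P hP)⟩
  neg_mem' hs := ⟨hs.1.neg, fun P hP => (hs.2 P hP).neg⟩

/-- Restriction of sections of `O(D)`. -/
noncomputable def restrict (D : C.Divisor) {U V : Opens C.X} (h : V ≤ U) : D.sections U →+ D.sections V where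
  toFun s := ⟨fun x => s.1 ⟨x.1, h x.2⟩, s.2.1.comp_continuous (continuous_inclusion h),
    fun P hP => s.2.2 P (h hP)⟩
  map_zero' := rfl
  map_add' _ _ := rfl

/-- `O(D)` as a presheaf of abelian groups. -/
noncomputable def presheaf (D : C.Divisor) : TopCat.Presheaf AddCommGrpCat.{u} C.X where
  obj U := AddCommGrpCat.of (D.sections U.unop)
  map i := AddCommGrpCat.ofHom (D.restrict i.unop.le)
  map_id _ := rfl
  map_comp _ _ := rfl

/-- The conditions that define the sections of `O(D)` are local. -/
def localPredicate (D : C.Divisor) : TopCat.LocalPredicate fun _ : C.X => C.FunctionField where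
  pred {U} s := s ∈ D.sections U
  res {U V} i s hs := (D.restrict i.le ⟨s, hs⟩).2
  locality {U} s hs := by
    refine ⟨(IsLocallyConstant.iff_exists_open s).2 fun x => ?_, fun P hP => ?_⟩
    · obtain ⟨V, hxV, i, hV⟩ := hs x
      obtain ⟨W, hW, hxW, hc⟩ := (IsLocallyConstant.iff_exists_open _).1 hV.1 ⟨x.1, hxV⟩
      refine ⟨Subtype.val ⁻¹' (Subtype.val '' W),
        (V.isOpen.isOpenMap_subtype_val _ hW).preimage continuous_subtype_val,
        ⟨⟨x.1, hxV⟩, hxW, rfl⟩, ?_⟩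
      rintro y ⟨z, hz, hzy⟩
      obtain rfl : y = ⟨z.1, i.le z.2⟩ := Subtype.ext hzy.symm
      exact hc z hz
    · obtain ⟨V, hxV, i, hV⟩ := hs ⟨P.1, hP⟩
      exact hV.2 P hxV

theorem presheaf_isSheaf (D : C.Divisor) : D.presheaf.IsSheaf := by
  rw [TopCat.Presheaf.isSheaf_iff_isSheaf_comp (forget AddCommGrpCat.{u})]
  exact TopCat.subpresheafToTypes.isSheaf D.localPredicate

/-- The invertible sheaf `O(D)`, as a sheaf of abelian groups. -/
noncomputable def sheaf (D : C.Divisor) : TopCat.Sheaf AddCommGrpCat.{u} C.X := ⟨D.presheaf, D.presheaf_isSheaf⟩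

/-- The line bundle `O(D)` is nonspecial: `h¹(X, O(D)) = 0`, with the sheaf cohomology of the
Zariski topology. -/
def IsNonspecial (D : C.Divisor) : Prop := Subsingleton (Sheaf.H.{u} D.sheaf 1)

/-- The complete linear system `|D|` of effective divisors linearly equivalent to `D`. -/
def completeLinearSystem (D : C.Divisor) : Set C.Divisor := {E | 0 ≤ E ∧ E.LinEquiv D}

/-- `dim |D| = h⁰(X, O(D)) - 1`. -/
noncomputable def dimSystem (D : C.Divisor) : ℤ := (D.h0 : ℤ) - 1

end Divisor

/-- The order at `P` of a rational differential `ω` is `n`: one has `ω = f dt` with `t` a uniformizer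
of the local ring at `P` and `ord_P f = n`. -/
def DifferentialHasOrd (ω : Ω[C.FunctionField⁄k]) (P : C.Point) (n : ℤ) : Prop :=
  ∃ (t : C.X.presheaf.stalk P.1) (f : C.FunctionField), Irreducible t ∧
    ω = f • KaehlerDifferential.D k C.FunctionField (algebraMap _ C.FunctionField t) ∧
    C.ord P f = n

namespace Divisor

/-- `K` is a canonical divisor: the divisor of a nonzero rational differential. -/
def IsCanonical (K : C.Divisor) : Prop :=
  ∃ ω : Ω[C.FunctionField⁄k], ω ≠ 0 ∧ ∀ P : C.Point, DifferentialHasOrd ω P (K P)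

variable [IsAlgClosed k]

/-- `g` is a complete `g^r_d`: a complete linear system of dimension `r` and degree `d`. -/
def IsCompleteGrd (g : Set C.Divisor) (r : ℕ) (d : ℤ) : Prop :=
  g.Nonempty ∧ ∀ D ∈ g, g = D.completeLinearSystem ∧ D.dimSystem = r ∧ D.deg = d

/-- `L ≃ K - A + E` is a presentation of the nonspecial line bundle `L`: `A` is an effective divisor
with `h⁰(O(A)) = 1`, `E > 0`, and `gcd(A, E) = 0`. -/
structure IsPresentation (K L A E : C.Divisor) : Prop where
  effective : 0 ≤ A
  h0_eq_one : A.h0 = 1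
  pos : 0 < E
  gcd_eq_zero : A ⊓ E = 0
  linEquiv : L.LinEquiv (K - A + E)

/-- The presentation `L ≃ K - A + E` is minimal: `deg E ≤ deg F` for every presentation
`L ≃ K - B + F`. -/
structure IsMinimalPresentation (K L A E : C.Divisor) : Prop extends IsPresentation K L A E where
  minimal : ∀ B F : C.Divisor, IsPresentation K L B F → E.deg ≤ F.deg

end Divisor

end SmoothCurve

/-! Put A = D - (ξ,D) and E = ξ - (ξ,D). The linear-system part is short. If E > 0 and A moved, a
member of |A| could be forced through a point of E, which would enlarge the gcd beyond β; hence
h⁰(A) = 1 (`h0_sub_inf_eq_one`). If K - B + F were a presentation with deg F < e - β, then B + ξ ~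
D₀ + F while adding F to D₀ does not change h⁰. So F is a fixed part (`le_of_linEquiv_add`), B + ξ -
F lies in the linear system, and its gcd with ξ contains ξ - F, of degree > β.

The hard point is E ≠ 0. Otherwise L ~ K - A with A effective, against h¹(K - A) = h⁰(A) > 0. Only
this consequence of Serre duality is needed, and `IsNonspecial.not_nonneg` proves it directly. If H¹
vanishes, Mayer-Vietoris shows that every finite system of principal parts modulo O(K) comes from a
rational function (`exists_hasPolesLE_sub`). Choose x with dx ≠ 0. Some differential h dx then has
the principal part of dx/x at the poles of x and is regular elsewhere. Its residues would add up to
-[F : k(x)] ≠ 0, F being the function field.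

The residue theorem is replaced by the trace from F to k(x). A second use of nonspeciality writes h
= a + dg/dx with a and g integral over k[x]. The trace commutes with d/dx, so p = Tr h is a
polynomial in x. At infinity x p must tend to n = [F : k(x)], which is impossible because n ≠ 0 in
characteristic zero (`not_forall_valuationSubring_mem_nonunits`). The valuative criterion of
properness (`exists_point_of_valuationSubring`) translates between valuation rings of F and points
of the curve. -/

/-! ### Splitting sections when H¹ vanishes -/

namespace CategoryTheory.Sheaf
open Opposite Limits Abelian

universe w v' u'
variable {C : Type u'} [Category.{v'} C] {J : GrothendieckTopology C}
  [HasSheafify J AddCommGrpCat.{v'}]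

/-- The section of `F` over `X` that corresponds to a morphism from the free abelian sheaf on the
representable presheaf of `X`. -/
noncomputable def sectionOfHom (F : Sheaf J AddCommGrpCat.{v'}) {X : C}
    (φ : (presheafToSheaf J _).obj (yoneda.obj X ⋙ AddCommGrpCat.free) ⟶ F) : F.obj.obj (op X) :=
  ((sheafificationAdjunction J _).homEquiv _ _ φ).app (op X) (FreeAbelianGroup.of (𝟙 X))

theorem sectionOfHom_map_comp (F : Sheaf J AddCommGrpCat.{v'}) {X Y : C} (f : X ⟶ Y)
    (φ : (presheafToSheaf J _).obj (yoneda.obj Y ⋙ AddCommGrpCat.free) ⟶ F) :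
    F.sectionOfHom ((presheafToSheaf J _).map
      (Functor.whiskerRight (yoneda.map f) AddCommGrpCat.free) ≫ φ) =
      F.obj.map f.op (F.sectionOfHom φ) := by
  unfold sectionOfHom
  rw [Adjunction.homEquiv_naturality_left]
  set ψ := (sheafificationAdjunction J AddCommGrpCat).homEquiv _ _ φ
  have h := ConcreteCategory.congr_hom (ψ.naturality f.op) (FreeAbelianGroup.of (𝟙 Y))
  refine Eq.trans ?_ h
  change ψ.app (op X) (FreeAbelianGroup.map _ (FreeAbelianGroup.of (𝟙 X))) =
    ψ.app (op X) (FreeAbelianGroup.map _ (FreeAbelianGroup.of (𝟙 Y)))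
  congr 1
  simp [FreeAbelianGroup.map_of_apply]

theorem sectionOfHom_sub (F : Sheaf J AddCommGrpCat.{v'}) {X : C}
    (φ ψ : (presheafToSheaf J _).obj (yoneda.obj X ⋙ AddCommGrpCat.free) ⟶ F) :
    F.sectionOfHom (φ - ψ) = F.sectionOfHom φ - F.sectionOfHom ψ := by
  simp only [sectionOfHom, Adjunction.homEquiv_unit]
  rfl

theorem sectionOfHom_surjective (F : Sheaf J AddCommGrpCat.{v'}) {X : C} :
    Function.Surjective (F.sectionOfHom (X := X)) := by
  intro s
  let ψ : yoneda.obj X ⋙ AddCommGrpCat.free ⟶ F.obj :=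
    { app := fun Y => AddCommGrpCat.ofHom
        (FreeAbelianGroup.lift fun (g : Y.unop ⟶ X) => F.obj.map g.op s)
      naturality := fun Y Z g => by
        refine AddCommGrpCat.hom_ext (FreeAbelianGroup.lift_ext _ _ fun x => ?_)
        change FreeAbelianGroup.lift _ (FreeAbelianGroup.map _ (FreeAbelianGroup.of x)) =
          F.obj.map g (FreeAbelianGroup.lift _ (FreeAbelianGroup.of x))
        simp [FreeAbelianGroup.map_of_apply] }
  refine ⟨((sheafificationAdjunction J _).homEquiv _ _).symm ψ, ?_⟩
  simp only [sectionOfHom, Equiv.apply_symm_apply]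
  change FreeAbelianGroup.lift _ (FreeAbelianGroup.of _) = _
  simp

/-- The constant sheaf of integers is the free abelian sheaf on a terminal object. -/
noncomputable def constantSheafIso {T : C} (hT : IsTerminal T) :
    (constantSheaf J AddCommGrpCat.{v'}).obj (AddCommGrpCat.of (ULift ℤ)) ≅
      (presheafToSheaf J _).obj (yoneda.obj T ⋙ AddCommGrpCat.free) :=
  (presheafToSheaf J _).mapIso (NatIso.ofComponents
    (fun U => haveI : Unique (U.unop ⟶ T) := ⟨⟨hT.from _⟩, fun _ => hT.hom_ext _ _⟩
      (((FreeAbelianGroup.uniqueEquiv (U.unop ⟶ T)).trans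
        AddEquiv.ulift.symm).toAddCommGrpIso).symm)
    (fun {U V} f => by
      refine AddCommGrpCat.hom_ext (AddMonoidHom.ext fun ⟨n⟩ => ?_)
      change n • FreeAbelianGroup.of (hT.from V.unop) =
        FreeAbelianGroup.map _ (n • FreeAbelianGroup.of (hT.from U.unop))
      rw [map_zsmul, FreeAbelianGroup.map_of_apply]
      congr 2
      exact hT.hom_ext _ _))

theorem _root_.CategoryTheory.Limits.biprod_lift_neg_comp {A : Type*} [Category* A]
    [Preadditive A] {X Y Z T : A} [HasBinaryBiproduct Y Z] (f : X ⟶ Y) (g : X ⟶ Z)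
    (ψ : Y ⊞ Z ⟶ T) :
    biprod.lift f (-g) ≫ ψ = f ≫ biprod.inl ≫ ψ - g ≫ biprod.inr ≫ ψ := by
  have h : ψ = biprod.desc (biprod.inl ≫ ψ) (biprod.inr ≫ ψ) := by
    apply biprod.hom_ext' <;> simp
  conv_lhs => rw [h, biprod.lift_desc]
  simp [sub_eq_add_neg]

/-- If the first cohomology of an abelian sheaf vanishes, then a section over the upper corner of a
Mayer-Vietoris square with terminal last vertex is a difference of restrictions. -/
theorem exists_map_sub_map_eq [HasWeakSheafify J (Type v')] [HasExt.{w} (Sheaf J AddCommGrpCat.{v'})]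
    (F : Sheaf J AddCommGrpCat.{v'}) (hF : Subsingleton (F.H 1)) (S : J.MayerVietorisSquare)
    (hS : IsTerminal S.X₄) (s : F.obj.obj (op S.X₁)) :
    ∃ (a : F.obj.obj (op S.X₂)) (b : F.obj.obj (op S.X₃)),
      F.obj.map S.f₁₂.op a - F.obj.map S.f₁₃.op b = s := by
  obtain ⟨φ, rfl⟩ := F.sectionOfHom_surjective s
  -- Cohomology is Ext out of the constant sheaf ℤ, which is the free sheaf on the terminal `S.X₄`.
  -- So this Ext¹ vanishes, and every morphism to F from the free sheaf on `S.X₁` extends to the sum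
  -- of those on `S.X₂` and `S.X₃`.
  have hsub : Subsingleton (Ext S.shortComplex.X₃ F 1) := by
    refine ⟨fun x y => ?_⟩
    have h : ∀ z : Ext ((presheafToSheaf J _).obj (yoneda.obj S.X₄ ⋙ AddCommGrpCat.free)) F 1,
        z = 0 := fun z => by
      have h0 : (Ext.mk₀ (constantSheafIso hS).hom).comp z (zero_add 1) = 0 :=
        hF.elim _ _
      have h1 := congr((Ext.mk₀ (constantSheafIso hS).inv).comp $h0 (zero_add 1))
      rwa [Ext.mk₀_comp_mk₀_assoc, Iso.inv_hom_id, Ext.mk₀_id_comp, Ext.comp_zero] at h1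
    exact (h x).trans (h y).symm
  obtain ⟨x, hx⟩ := Ext.contravariant_sequence_exact₁ S.shortComplex_shortExact F (Ext.mk₀ φ) rfl
    (Subsingleton.elim _ _)
  obtain ⟨ψ, rfl⟩ := Ext.addEquiv₀.symm.surjective x
  refine ⟨F.sectionOfHom (biprod.inl ≫ ψ), F.sectionOfHom (biprod.inr ≫ ψ), ?_⟩
  rw [← sectionOfHom_map_comp, ← sectionOfHom_map_comp, ← sectionOfHom_sub]
  congr 1
  have h1 : S.shortComplex.f ≫ ψ = φ := by
    apply (Ext.mk₀_bijective _ _).1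
    rw [← hx, ← Ext.mk₀_comp_mk₀]
    rfl
  exact (biprod_lift_neg_comp _ _ ψ).symm.trans h1

end CategoryTheory.Sheaf

theorem TopCat.Sheaf.exists_map_sub_map_eq {X : TopCat.{u}} (F : TopCat.Sheaf AddCommGrpCat.{u} X)
    (hF : Subsingleton (Sheaf.H.{u} F 1)) {U V : Opens X} (h : U ⊔ V = ⊤)
    (s : F.obj.obj (.op (U ⊓ V))) :
    ∃ (a : F.obj.obj (.op U)) (b : F.obj.obj (.op V)),
      F.obj.map (homOfLE inf_le_left).op a - F.obj.map (homOfLE inf_le_right).op b = s :=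
  CategoryTheory.Sheaf.exists_map_sub_map_eq F hF (Opens.mayerVietorisSquare U V)
    (Limits.IsTerminal.ofUniqueHom (fun _ => homOfLE (le_top.trans h.ge)) fun _ _ => rfl) s

/-! ### Local algebra: residue fields and differentials -/

/-- Over an algebraically closed field, the residue field at a maximal ideal of an algebra of finite
type consists of constants. -/
theorem exists_sub_algebraMap_mem_maximalIdeal {k A R : Type*} [Field k] [IsAlgClosed k] [CommRing A]
    [Algebra k A] [Algebra.FiniteType k A] (m : Ideal A) [hm : m.IsMaximal] [CommRing R]
    [IsLocalRing R] [Algebra A R] [IsLocalization.AtPrime R m] [Algebra k R] [IsScalarTower k A R]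
    (x : R) : ∃ c : k, x - algebraMap k R c ∈ IsLocalRing.maximalIdeal R := by
  let κ := IsLocalRing.ResidueField R
  have hAκ : Function.Surjective (algebraMap A κ) := by
    intro y
    obtain ⟨x, rfl⟩ := IsLocalRing.residue_surjective y
    obtain ⟨z, hz⟩ := (IsLocalization.AtPrime.equivQuotMaximalIdeal m R).surjective
      (Ideal.Quotient.mk _ x)
    obtain ⟨a, rfl⟩ := Ideal.Quotient.mk_surjective z
    refine ⟨a, ?_⟩
    have h2 : algebraMap A (R ⧸ IsLocalRing.maximalIdeal R) a =
        Ideal.Quotient.mk (IsLocalRing.maximalIdeal R) x := by simpa using hz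
    exact h2
  have : Algebra.FiniteType k κ :=
    Algebra.FiniteType.of_surjective (IsScalarTower.toAlgHom k A κ) hAκ
  have : Module.Finite k κ := finite_of_finite_type_of_isJacobsonRing k κ
  obtain ⟨c, hc⟩ := (IsAlgClosed.algebraMap_bijective_of_isIntegral (k := k) (K := κ)).2
    (IsLocalRing.residue R x)
  refine ⟨c, ?_⟩
  rw [← IsLocalRing.residue_eq_zero_iff, map_sub, ← hc, sub_eq_zero]
  rfl

/-- If a local ring essentially of finite type over `k` has residue field `k` and principal maximal
ideal `(t)`, its differentials are generated by `dt`. -/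
theorem span_D_eq_top_of_maximalIdeal_eq_span {k R : Type*} [CommRing k] [CommRing R]
    [IsLocalRing R] [Algebra k R] [Algebra.EssFiniteType k R]
    (h : ∀ x : R, ∃ c : k, x - algebraMap k R c ∈ IsLocalRing.maximalIdeal R) {t : R}
    (ht : IsLocalRing.maximalIdeal R = Ideal.span {t}) :
    Submodule.span R {KaehlerDifferential.D k R t} = ⊤ := by
  -- Nakayama: with x = c + t y one has dx = y dt + t dy, so dt generates modulo the maximal ideal.
  -- Essential finite type makes the module of differentials finite.
  refine top_le_iff.1 (Submodule.le_of_le_smul_of_le_jacobson_bot (I := IsLocalRing.maximalIdeal R)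
    Module.Finite.fg_top (IsLocalRing.jacobson_eq_maximalIdeal _ bot_ne_top).ge ?_)
  rw [← KaehlerDifferential.span_range_derivation, Submodule.span_le]
  rintro _ ⟨x, rfl⟩
  obtain ⟨c, hc⟩ := h x
  rw [ht, Ideal.mem_span_singleton] at hc
  obtain ⟨y, hy⟩ := hc
  have hx : KaehlerDifferential.D k R x = y • KaehlerDifferential.D k R t +
      t • KaehlerDifferential.D k R y := by
    rw [sub_eq_iff_eq_add.1 hy, map_add, Derivation.leibniz, Derivation.map_algebraMap, add_zero,
      add_comm]
  rw [SetLike.mem_coe, hx]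
  refine Submodule.add_mem_sup (Submodule.smul_mem _ _ (Submodule.mem_span_singleton_self _))
    (Submodule.smul_mem_smul ?_ (Submodule.subset_span ⟨y, rfl⟩))
  rw [ht]
  exact Ideal.mem_span_singleton_self t

/-! ### Orders, local rings and differentials at a point -/

namespace SmoothCurve
variable {k : Type u} [Field k] (C : SmoothCurve k)

/-- Constants in the local ring at a point. -/
noncomputable instance algebraStalk (x : C.X) : Algebra k (C.X.presheaf.stalk x) :=
  RingHom.toAlgebra ((C.X.presheaf.germ ⊤ x trivial).hom.comp
    (C.π.appTop.hom.comp (Scheme.ΓSpecIso (.of k)).inv.hom))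

instance isScalarTower_stalk (x : C.X) :
    IsScalarTower k (C.X.presheaf.stalk x) C.FunctionField := by
  refine IsScalarTower.of_algebraMap_eq fun c => ?_
  exact (Scheme.algebraMap_germ_eq_germToFunctionField (X := C.X) (U := ⊤) (x := x) trivial _).symm

section
variable {C}

theorem ord_zero (P : C.Point) : C.ord P 0 = 0 := by simp [ord]

theorem ord_one (P : C.Point) : C.ord P 1 = 0 := by
  simpa using C.ord_algebraMap P (c := 1) one_ne_zero

theorem ord_inv (P : C.Point) (f : C.FunctionField) : C.ord P f⁻¹ = - C.ord P f := by
  by_cases hf : f = 0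
  · simp [hf, ord_zero]
  have := C.ord_mul P hf (inv_ne_zero hf)
  rw [mul_inv_cancel₀ hf, ord_one] at this
  linarith

theorem ord_div (P : C.Point) {f g : C.FunctionField} (hf : f ≠ 0) (hg : g ≠ 0) :
    C.ord P (f / g) = C.ord P f - C.ord P g := by
  rw [div_eq_mul_inv, C.ord_mul P hf (inv_ne_zero hg), ord_inv, sub_eq_add_neg]

theorem ord_pow (P : C.Point) {f : C.FunctionField} (hf : f ≠ 0) (n : ℕ) :
    C.ord P (f ^ n) = n * C.ord P f := by
  induction n with
  | zero => simp [ord_one]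
  | succ n ih => rw [pow_succ, C.ord_mul P (pow_ne_zero _ hf) hf, ih]; push_cast; ring

theorem ord_mul_nonneg (P : C.Point) {f g : C.FunctionField} (hf : 0 ≤ C.ord P f)
    (hg : 0 ≤ C.ord P g) : 0 ≤ C.ord P (f * g) := by
  rcases eq_or_ne f 0 with rfl | hf0
  · simp [ord_zero]
  rcases eq_or_ne g 0 with rfl | hg0
  · simp [ord_zero]
  · rw [C.ord_mul P hf0 hg0]
    positivity

/-- A chart around a point: an affine open neighbourhood on which the curve is standard smooth. -/
theorem exists_affine_chart (x : C.X) :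
    ∃ (V : C.X.Opens) (hxV : x ∈ V) (_ : IsAffineOpen V) (_ : Algebra k Γ(C.X, V)),
      Algebra.FiniteType k Γ(C.X, V) ∧ ∀ c : k,
        C.X.presheaf.germ V x hxV (algebraMap k Γ(C.X, V) c) =
          algebraMap k (C.X.presheaf.stalk x) c := by
  obtain ⟨U, hU, V, hV, hxV, e, h⟩ :=
    SmoothOfRelativeDimension.exists_isStandardSmoothOfRelativeDimension (n := 1) (f := C.π) x
  have hUtop : U = ⊤ := by
    ext y
    have hy : C.π x ∈ U := e hxV
    have : y = C.π x := Subsingleton.elim (α := PrimeSpectrum k) _ _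
    simp [this, hy]
  subst hUtop
  have : Nonempty V := ⟨⟨_, hxV⟩⟩
  let φ : k →+* Γ(C.X, V) := (C.π.appLE ⊤ V e).hom.comp (Scheme.ΓSpecIso (.of k)).inv.hom
  have hφ : φ.IsStandardSmoothOfRelativeDimension 1 :=
    RingHom.isStandardSmoothOfRelativeDimension_respectsIso.2 _
      (Scheme.ΓSpecIso (.of k)).symm.commRingCatIsoToRingEquiv h
  let := φ.toAlgebra
  have : Algebra.IsStandardSmoothOfRelativeDimension 1 k Γ(C.X, V) := hφ
  have := Algebra.IsStandardSmoothOfRelativeDimension.isStandardSmooth (R := k) (S := Γ(C.X, V)) 1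
  refine ⟨V, hxV, hV, inferInstance, inferInstance, fun c => ?_⟩
  change C.X.presheaf.germ V x hxV (C.π.appLE ⊤ V e _) = C.X.presheaf.germ ⊤ x trivial _
  rw [Scheme.Hom.appLE]
  exact C.X.presheaf.germ_res_apply (homOfLE le_top) x hxV _

end

variable [IsAlgClosed k] {C}

theorem ord_algebraMap_stalk (P : C.Point) {a : C.X.presheaf.stalk P.1} (ha : a ≠ 0) {n : ℕ}
    (hn : Ring.ord _ a = n) : C.ord P (algebraMap _ C.FunctionField a) = n := by
  have hP := C.coheight_point P
  rw [ord, Scheme.ord_eq_iff hP (by simpa using ha)]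
  have : Ring.KrullDimLE 1 (C.X.presheaf.stalk P.1) :=
    krullDimLE_of_coheight_le hP.le
  refine (Ring.ordFrac_eq_ord _ ha).trans ?_
  exact Ring.ordMonoidWithZeroHom_eq_coe _ (mem_nonZeroDivisors_of_ne_zero ha) hn

theorem ord_algebraMap_stalk_nonneg (P : C.Point) (a : C.X.presheaf.stalk P.1) :
    0 ≤ C.ord P (algebraMap _ C.FunctionField a) := by
  by_cases ha : a = 0
  · simp [ha, ord_zero]
  have : Ring.KrullDimLE 1 (C.X.presheaf.stalk P.1) :=
    krullDimLE_of_coheight_le (C.coheight_point P).le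
  obtain ⟨n, hn⟩ := ENat.ne_top_iff_exists.1 (Ring.ord_ne_top (mem_nonZeroDivisors_of_ne_zero ha))
  rw [ord_algebraMap_stalk P ha hn.symm]
  positivity

theorem ord_irreducible (P : C.Point) {t : C.X.presheaf.stalk P.1} (ht : Irreducible t) :
    C.ord P (algebraMap _ C.FunctionField t) = 1 := by
  have := C.isDVR_stalk P
  exact ord_algebraMap_stalk P ht.ne_zero (Ring.ord_of_irreducible ht)

theorem ord_pos_of_mem_maximalIdeal (P : C.Point) {a : C.X.presheaf.stalk P.1} (h0 : a ≠ 0)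
    (ha : a ∈ IsLocalRing.maximalIdeal (C.X.presheaf.stalk P.1)) :
    0 < C.ord P (algebraMap _ C.FunctionField a) := by
  have := C.isDVR_stalk P
  obtain ⟨t, ht⟩ := IsDiscreteValuationRing.exists_irreducible (C.X.presheaf.stalk P.1)
  rw [ht.maximalIdeal_eq, Ideal.mem_span_singleton] at ha
  obtain ⟨b, rfl⟩ := ha
  rw [map_mul, C.ord_mul P (by simpa using left_ne_zero_of_mul h0)
    (by simpa using right_ne_zero_of_mul h0), ord_irreducible P ht]
  linarith [ord_algebraMap_stalk_nonneg P b]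

/-- The local ring is a valuation ring, so f or its inverse belongs to it; a nonunit inverse would
give f negative order. The convention that zero has order 0 lets f = 0 fit. -/
theorem ord_nonneg_iff (P : C.Point) {f : C.FunctionField} :
    0 ≤ C.ord P f ↔ ∃ a : C.X.presheaf.stalk P.1, algebraMap _ C.FunctionField a = f := by
  refine ⟨fun h => ?_, ?_⟩
  · have := C.isDVR_stalk P
    rcases ValuationRing.isInteger_or_isInteger (C.X.presheaf.stalk P.1) f with ⟨a, ha⟩ | ⟨a, ha⟩
    · exact ⟨a, ha⟩
    · rcases eq_or_ne a 0 with rfl | ha0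
      · refine ⟨0, ?_⟩
        rw [map_zero] at ha ⊢
        exact (inv_eq_zero.1 ha.symm).symm
      by_cases hu : IsUnit a
      · refine ⟨↑hu.unit⁻¹, ?_⟩
        rw [← inv_inv f, ← ha]
        refine eq_inv_of_mul_eq_one_left ?_
        rw [← map_mul, IsUnit.val_inv_mul, map_one]
      · have := ord_pos_of_mem_maximalIdeal P ha0 ((IsLocalRing.mem_maximalIdeal a).2 hu)
        rw [ha, ord_inv] at this
        linarith
  · rintro ⟨a, rfl⟩
    exact ord_algebraMap_stalk_nonneg P a

theorem exists_irreducible_stalk (P : C.Point) :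
    ∃ t : C.X.presheaf.stalk P.1, Irreducible t := by
  have := C.isDVR_stalk P
  exact IsDiscreteValuationRing.exists_irreducible (C.X.presheaf.stalk P.1)

theorem ord_add_nonneg (P : C.Point) {f g : C.FunctionField} (hf : 0 ≤ C.ord P f)
    (hg : 0 ≤ C.ord P g) : 0 ≤ C.ord P (f + g) := by
  by_cases h : f + g = 0
  · simp [h, ord_zero]
  · exact (le_min hf hg).trans (C.min_ord_le_ord_add P h)

theorem exists_sub_algebraMap_mem_maximalIdeal_stalk (P : C.Point) (a : C.X.presheaf.stalk P.1) :
    ∃ c : k, a - algebraMap k _ c ∈ IsLocalRing.maximalIdeal (C.X.presheaf.stalk P.1) := by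
  obtain ⟨V, hxV, hV, _, _, h⟩ := exists_affine_chart P.1
  let := TopCat.Presheaf.algebra_section_stalk C.X.presheaf (⟨P.1, hxV⟩ : V)
  have := hV.isLocalization_stalk ⟨P.1, hxV⟩
  have := hV.primeIdealOf_isMaximal_of_isClosed ⟨P.1, hxV⟩ P.2
  have : IsScalarTower k Γ(C.X, V) (C.X.presheaf.stalk P.1) :=
    IsScalarTower.of_algebraMap_eq fun c => (h c).symm
  exact exists_sub_algebraMap_mem_maximalIdeal (hV.primeIdealOf ⟨P.1, hxV⟩).asIdeal a

instance essFiniteType_stalk (x : C.X) : Algebra.EssFiniteType k (C.X.presheaf.stalk x) := by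
  obtain ⟨V, hxV, hV, _, _, h⟩ := exists_affine_chart x
  let := TopCat.Presheaf.algebra_section_stalk C.X.presheaf (⟨x, hxV⟩ : V)
  have := hV.isLocalization_stalk ⟨x, hxV⟩
  have : IsScalarTower k Γ(C.X, V) (C.X.presheaf.stalk x) :=
    IsScalarTower.of_algebraMap_eq fun c => (h c).symm
  have : Algebra.EssFiniteType Γ(C.X, V) (C.X.presheaf.stalk x) :=
    Algebra.EssFiniteType.of_isLocalization _
      (hV.primeIdealOf ⟨x, hxV⟩).asIdeal.primeCompl
  exact Algebra.EssFiniteType.comp k Γ(C.X, V) _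

theorem span_D_stalk_eq_top (P : C.Point) {t : C.X.presheaf.stalk P.1} (ht : Irreducible t) :
    Submodule.span (C.X.presheaf.stalk P.1)
      {KaehlerDifferential.D k (C.X.presheaf.stalk P.1) t} = ⊤ := by
  have := C.isDVR_stalk P
  exact span_D_eq_top_of_maximalIdeal_eq_span
    (exists_sub_algebraMap_mem_maximalIdeal_stalk P) ht.maximalIdeal_eq

/-- The differential of a function regular at `P` is a regular multiple of `dt`. -/
theorem exists_D_eq_smul_D (P : C.Point) {t : C.X.presheaf.stalk P.1} (ht : Irreducible t)
    {f : C.FunctionField} (hf : 0 ≤ C.ord P f) :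
    ∃ u : C.FunctionField, 0 ≤ C.ord P u ∧ KaehlerDifferential.D k C.FunctionField f =
      u • KaehlerDifferential.D k C.FunctionField (algebraMap _ C.FunctionField t) := by
  obtain ⟨a, rfl⟩ := (ord_nonneg_iff P).1 hf
  have h : KaehlerDifferential.D k _ a ∈ Submodule.span (C.X.presheaf.stalk P.1)
      {KaehlerDifferential.D k (C.X.presheaf.stalk P.1) t} := by
    rw [span_D_stalk_eq_top P ht]; trivial
  obtain ⟨u, hu⟩ := Submodule.mem_span_singleton.1 h
  refine ⟨algebraMap _ _ u, ord_algebraMap_stalk_nonneg P u, ?_⟩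
  have h2 := congr(KaehlerDifferential.map k k (C.X.presheaf.stalk P.1) C.FunctionField $hu)
  rw [map_smul, KaehlerDifferential.map_D, KaehlerDifferential.map_D] at h2
  rw [← h2, algebraMap_smul]

/-- Each f or its inverse is regular at P, and d(1/f) is a multiple of df, so the local generator dt
suffices. -/
theorem span_D_functionField_eq_top (P : C.Point) {t : C.X.presheaf.stalk P.1}
    (ht : Irreducible t) : Submodule.span C.FunctionField
      {KaehlerDifferential.D k C.FunctionField (algebraMap _ C.FunctionField t)} = ⊤ := by
  rw [eq_top_iff, ← KaehlerDifferential.span_range_derivation, Submodule.span_le]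
  rintro _ ⟨f, rfl⟩
  rcases le_or_gt 0 (C.ord P f) with hf | hf
  · obtain ⟨u, -, hu⟩ := exists_D_eq_smul_D P ht hf
    exact Submodule.mem_span_singleton.2 ⟨u, hu.symm⟩
  · obtain ⟨u, -, hu⟩ := exists_D_eq_smul_D P ht (f := f⁻¹) (by rw [ord_inv]; linarith)
    rw [← inv_inv f, SetLike.mem_coe, Derivation.leibniz_inv, hu]
    exact Submodule.smul_mem _ _ (Submodule.smul_mem _ _ (Submodule.mem_span_singleton_self _))

/-- A function regular at `P` has a value at `P`. -/
theorem exists_ord_sub_algebraMap_pos (P : C.Point) {f : C.FunctionField} (hf : 0 ≤ C.ord P f) :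
    ∃ c : k, f = algebraMap k _ c ∨ 0 < C.ord P (f - algebraMap k _ c) := by
  obtain ⟨a, rfl⟩ := (ord_nonneg_iff P).1 hf
  obtain ⟨c, hc⟩ := exists_sub_algebraMap_mem_maximalIdeal_stalk P a
  refine ⟨c, ?_⟩
  rw [IsScalarTower.algebraMap_apply k (C.X.presheaf.stalk P.1) C.FunctionField, ← map_sub]
  by_cases h0 : a - algebraMap k _ c = 0
  · exact Or.inl (by rw [sub_eq_zero.1 h0])
  · exact Or.inr (ord_pos_of_mem_maximalIdeal P h0 hc)

end SmoothCurve

/-! ### Closed points and valuation rings of the function field -/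

namespace SmoothCurve
variable {k : Type u} [Field k] [IsAlgClosed k] {C : SmoothCurve k}

instance compactSpace : CompactSpace C.X := by
  have h : QuasiCompact C.π := inferInstance
  exact (quasiCompact_iff_compactSpace (f := C.π)).1 h

instance noetherianSpace : NoetherianSpace C.X :=
  have : IsNoetherian C.X := {}
  inferInstance

/-- The closure of x contains a closed point y, so x is a prime of the discrete valuation ring at y:
the zero ideal gives the generic point, the maximal ideal gives y. -/
theorem isClosed_singleton_of_ne_genericPoint {x : C.X} (hx : x ≠ genericPoint C.X) :
    IsClosed ({x} : Set C.X) := by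
  obtain ⟨y, hy, hcl⟩ := isClosed_closure.exists_closed_singleton
    (⟨x, subset_closure rfl⟩ : (closure ({x} : Set C.X)).Nonempty)
  have hxy : x ⤳ y := specializes_iff_mem_closure.2 hy
  let P : C.Point := ⟨y, hcl⟩
  have hdvr := C.isDVR_stalk P
  have hr : ∀ z, z ⤳ y → z ∈ Set.range (C.X.fromSpecStalk y) := fun z hz => by
    rw [Scheme.range_fromSpecStalk]; exact hz
  obtain ⟨p, hp⟩ := hr x hxy
  obtain ⟨q, hq⟩ := hr _ ((genericPoint_spec C.X).specializes trivial)
  by_cases hpb : p.asIdeal = ⊥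
  · refine absurd ?_ hx
    have hpq : p ⤳ q := by
      refine (PrimeSpectrum.le_iff_specializes p q).1 ?_
      change p.asIdeal ≤ q.asIdeal
      rw [hpb]
      exact bot_le
    have h1 := hpq.map (C.X.fromSpecStalk y).continuous
    rw [hp, hq] at h1
    exact (h1.antisymm ((genericPoint_spec C.X).specializes trivial)).eq
  · have : p.asIdeal.IsMaximal := p.isPrime.isMaximal hpb
    have h2 : p = IsLocalRing.closedPoint (C.X.presheaf.stalk y) :=
      PrimeSpectrum.ext (IsLocalRing.eq_maximalIdeal this)
    have h3 : C.X.fromSpecStalk y p = y := by rw [h2]; exact Scheme.fromSpecStalk_closedPoint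
    rw [← hp, h3]
    exact hcl

theorem finite_of_isClosed {Z : Set C.X} (hZ : IsClosed Z) (h : genericPoint C.X ∉ Z) :
    Z.Finite := by
  obtain ⟨S, hS, hcl, hirr, rfl⟩ := NoetherianSpace.exists_finite_set_isClosed_irreducible hZ
  refine hS.sUnion fun t ht => ?_
  obtain ⟨x, hx⟩ := QuasiSober.sober (hirr t ht) (hcl t ht)
  have hxt : x ∈ t := hx.mem
  rw [← hx.def, (isClosed_singleton_of_ne_genericPoint
    fun e => h ⟨t, ht, e ▸ hxt⟩).closure_eq]
  exact Set.finite_singleton x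

theorem finite_setOf_ord_ne_zero {f : C.FunctionField} (hf : f ≠ 0) :
    {P : C.Point | C.ord P f ≠ 0}.Finite := by
  obtain ⟨U, -, f', hU, rfl, hu⟩ := exists_isUnit_germ_eq C.X f hf
  have hfin : ((U : Set C.X)ᶜ).Finite := finite_of_isClosed U.isOpen.isClosed_compl
    fun h => h (((genericPoint_spec C.X).mem_open_set_iff U.isOpen).2
      (by simpa using hU))
  refine (hfin.preimage Subtype.val_injective.injOn).subset fun P hP hPU => hP ?_
  exact Scheme.ord_of_isUnit hu hPU

/-- The valuative criterion of properness: a proper valuation subring of the function field that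
contains the constants is the local ring at a point. -/
theorem exists_point_of_valuationSubring (V : ValuationSubring C.FunctionField)
    (hk : ∀ c : k, algebraMap k C.FunctionField c ∈ V) (hV : V ≠ ⊤) :
    ∃ P : C.Point, ∀ f : C.FunctionField, f ∈ V ↔ 0 ≤ C.ord P f := by
  let j : k →+* V := (algebraMap k C.FunctionField).codRestrict V.toSubring hk
  have hex : ValuativeCriterion.Existence C.π := by
    have : IsProper C.π := inferInstance
    rw [IsProper.eq_valuativeCriterion] at this
    exact ValuativeCriterion.existence this.1.1.1
  let S : ValuativeCommSq C.π :=
    { R := V, K := C.FunctionField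
      i₁ := C.X.fromSpecStalk (genericPoint C.X)
      i₂ := Spec.map (CommRingCat.ofHom j)
      commSq := ⟨by
        refine ext_of_isAffine ?_
        have h1 : (Spec.map (CommRingCat.ofHom (algebraMap V C.FunctionField)) ≫
            Spec.map (CommRingCat.ofHom j)).appTop = (Scheme.ΓSpecIso (.of k)).hom ≫
              CommRingCat.ofHom (algebraMap k C.FunctionField) ≫
              (Scheme.ΓSpecIso (.of C.FunctionField)).inv := by
          rw [← Spec.map_comp, ← CommRingCat.ofHom_comp, Scheme.ΓSpecIso_inv_naturality,
            Iso.hom_inv_id_assoc]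
          rfl
        have h2 : CommRingCat.ofHom (algebraMap k C.FunctionField) =
          (Scheme.ΓSpecIso (.of k)).inv ≫ C.π.appTop ≫
            C.X.presheaf.germ ⊤ (genericPoint C.X) trivial := rfl
        have h3 : (C.X.fromSpecStalk (genericPoint C.X)).appTop =
            C.X.presheaf.germ ⊤ (genericPoint C.X) trivial ≫
              (Scheme.ΓSpecIso (.of C.FunctionField)).inv := by
          rw [Scheme.fromSpecStalk_appTop]
          exact congr(_ ≫ _ ≫ $((Spec _).presheaf.map_id _)).trans (by rw [Category.comp_id]; rfl)
        rw [h1, Scheme.Hom.comp_appTop, h2, h3]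
        simp only [Category.assoc, Iso.hom_inv_id_assoc]⟩ }
  obtain ⟨⟨l, hl, -⟩⟩ := hex S
  let x : C.X := l (IsLocalRing.closedPoint V)
  let φ : C.X.presheaf.stalk x ⟶ .of V := Scheme.stalkClosedPointTo l
  have hφ : ∀ a, (φ a : C.FunctionField) = algebraMap (C.X.presheaf.stalk x) C.FunctionField a := by
    have h1 : φ ≫ CommRingCat.ofHom (algebraMap V C.FunctionField) =
        C.X.presheaf.stalkSpecializes ((genericPoint_spec C.X).specializes trivial) := by
      apply Spec.map_injective
      rw [← cancel_mono (C.X.fromSpecStalk x), Scheme.SpecMap_stalkSpecializes_fromSpecStalk,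
        Spec.map_comp, Category.assoc, Scheme.Spec_stalkClosedPointTo_fromSpecStalk]
      exact hl
    exact fun a => ConcreteCategory.congr_hom h1 a
  -- V dominates the local ring at the centre x. If x were generic that ring would be the whole
  -- function field, forcing V = ⊤; otherwise it is a valuation ring, and domination becomes
  -- equality.
  have hloc : IsLocalHom φ.hom := inferInstance
  have hx : IsClosed ({x} : Set C.X) := by
    apply isClosed_singleton_of_ne_genericPoint
    refine fun hgen => hV (top_le_iff.1 fun f _ => ?_)
    have hfield : IsField (C.X.presheaf.stalk x) := by
      rw [hgen]
      exact Field.toIsField C.FunctionField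
    obtain ⟨a, b, hb, rfl⟩ := IsFractionRing.div_surjective (A := C.X.presheaf.stalk x) f
    obtain ⟨c, hc⟩ := hfield.mul_inv_cancel (nonZeroDivisors.ne_zero hb)
    have h1 : algebraMap _ C.FunctionField a / algebraMap _ C.FunctionField b = φ (a * c) := by
      rw [hφ, div_eq_iff (by simpa using nonZeroDivisors.ne_zero hb), ← map_mul, mul_assoc,
        mul_comm c, hc, mul_one]
    rw [h1]
    exact (φ (a * c)).2
  refine ⟨⟨x, hx⟩, fun f => ⟨fun hf => ?_, fun hf => ?_⟩⟩
  · by_contra hneg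
    obtain ⟨a, ha⟩ := (ord_nonneg_iff (C := C) ⟨x, hx⟩ (f := f⁻¹)).1 (by
      rw [ord_inv]; linarith)
    have hf0 : f ≠ 0 := by
      rintro rfl
      exact hneg (ord_zero _).ge
    have hu : IsUnit (φ a) := by
      refine IsUnit.of_mul_eq_one ⟨f, hf⟩ (Subtype.ext ?_)
      change (φ a : C.FunctionField) * f = 1
      rw [hφ, ha, inv_mul_cancel₀ hf0]
    obtain ⟨b, hb⟩ := (hloc.map_nonunit a hu).exists_right_inv
    refine hneg ((ord_nonneg_iff (C := C) ⟨x, hx⟩).2 ⟨b, ?_⟩)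
    have h1 : f⁻¹ * algebraMap _ C.FunctionField b = 1 := by rw [← ha, ← map_mul, hb, map_one]
    rw [eq_inv_of_mul_eq_one_right h1, inv_inv]
  · obtain ⟨a, rfl⟩ := (ord_nonneg_iff (C := C) ⟨x, hx⟩).1 hf
    rw [← hφ]
    exact (φ a).2

end SmoothCurve

/-! ### Principal parts on a nonspecial line bundle -/

namespace SmoothCurve
variable {k : Type u} [Field k] [IsAlgClosed k] {C : SmoothCurve k}

theorem Point.ne_genericPoint (P : C.Point) : P.1 ≠ genericPoint C.X := by
  intro h
  have := C.isDVR_stalk P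
  refine IsDiscreteValuationRing.not_isField (C.X.presheaf.stalk P.1) ?_
  rw [h]
  exact Field.toIsField C.FunctionField

omit [IsAlgClosed k] in
theorem genericPoint_mem {U : Opens C.X} {x : C.X} (hx : x ∈ U) : genericPoint C.X ∈ U :=
  ((genericPoint_spec C.X).mem_open_set_iff U.isOpen).2 (by simpa using ⟨x, hx⟩)

namespace Divisor

/-- The fibre of s through x is open and nonempty, so it contains the generic point. -/
theorem section_eq_genericPoint {D : C.Divisor} {U : Opens C.X} (s : D.sections U) (x : U) :
    s.1 x = s.1 ⟨genericPoint C.X, genericPoint_mem x.2⟩ := by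
  have hs : IsOpen (s.1 ⁻¹' {s.1 x}) := s.2.1 _
  have hW := U.isOpen.isOpenMap_subtype_val _ hs
  obtain ⟨y, hy, hy'⟩ : genericPoint C.X ∈ Subtype.val '' (s.1 ⁻¹' {s.1 x}) :=
    ((genericPoint_spec C.X).mem_open_set_iff hW).2 ⟨x.1, trivial, x, rfl, rfl⟩
  obtain rfl : y = ⟨genericPoint C.X, genericPoint_mem x.2⟩ := Subtype.ext hy'
  exact Eq.symm hy

/-- The constant section of `O(D)` given by a rational function with suitable poles. -/
def constSection (D : C.Divisor) (U : Opens C.X) (f : C.FunctionField)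
    (hf : ∀ P : C.Point, P.1 ∈ U → D.HasPolesLE P f) : D.sections U :=
  ⟨fun _ => f, IsLocallyConstant.const f, hf⟩

/-- Cover X by U = X ∖ {P} and by V, the complement of the points other than P where s or L has
nonzero order or coefficient. On U ∩ V, s is a section of O(L), so s = a - b with a over U and b
over V. Then f = a works, since f - s = b near P. -/
theorem exists_hasPolesLE_sub_single {L : C.Divisor} (hL : L.IsNonspecial) (P : C.Point)
    (s : C.FunctionField) :
    ∃ f : C.FunctionField, L.HasPolesLE P (f - s) ∧ ∀ Q ≠ P, L.HasPolesLE Q f := by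
  rcases eq_or_ne s 0 with rfl | hs
  · exact ⟨0, Or.inl (sub_zero 0), fun Q _ => HasPolesLE.zero⟩
  let T : Set C.Point := {Q | C.ord Q s ≠ 0} ∪ L.support
  have hT : T.Finite := (finite_setOf_ord_ne_zero hs).union L.support.finite_toSet
  have hTcl : IsClosed (Subtype.val '' (T \ {P}) : Set C.X) := by
    rw [← Set.biUnion_of_singleton (Subtype.val '' (T \ {P}))]
    refine (hT.subset Set.sdiff_subset |>.image _).isClosed_biUnion ?_
    rintro _ ⟨Q, -, rfl⟩
    exact Q.2
  let U : Opens C.X := ⟨{P.1}ᶜ, P.2.isOpen_compl⟩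
  let V : Opens C.X := ⟨(Subtype.val '' (T \ {P}))ᶜ, hTcl.isOpen_compl⟩
  have hPV : P.1 ∈ V := by
    rintro ⟨Q, hQ, h⟩
    exact hQ.2 (Subtype.ext h)
  have hUV : U ⊔ V = ⊤ := by
    refine top_le_iff.1 fun x _ => ?_
    by_cases hx : x = P.1
    · exact Or.inr (hx ▸ hPV)
    · exact Or.inl hx
  have hη : genericPoint C.X ∈ U ⊓ V := ⟨P.ne_genericPoint.symm, genericPoint_mem hPV⟩
  obtain ⟨a, b, hab⟩ := TopCat.Sheaf.exists_map_sub_map_eq L.sheaf hL hUV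
    (L.constSection (U ⊓ V) s fun Q hQ => Or.inr (by
      have hQT : Q ∉ T := fun h => hQ.2 ⟨Q, ⟨h, fun e => hQ.1 (congrArg Subtype.val e)⟩, rfl⟩
      simp only [T, Set.mem_union, Set.mem_ofPred_eq, not_or, not_not, Finset.mem_coe,
        Finsupp.notMem_support_iff] at hQT
      rw [hQT.1, hQT.2, neg_zero]))
  change L.sections U at a
  change L.sections V at b
  have h1 : a.1 ⟨_, hη.1⟩ - b.1 ⟨_, hη.2⟩ = s :=
    congr_fun (congrArg Subtype.val hab) ⟨genericPoint C.X, hη⟩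
  refine ⟨a.1 ⟨_, hη.1⟩, ?_, fun Q hQ => ?_⟩
  · have h2 := b.2.2 P hPV
    rw [section_eq_genericPoint] at h2
    rwa [← h1, sub_sub_cancel]
  · have h2 := a.2.2 Q fun e => hQ (Subtype.ext e)
    rwa [section_eq_genericPoint] at h2

/-- On a nonspecial line bundle every finite system of principal parts is realized by a rational
function. -/
theorem exists_hasPolesLE_sub {L : C.Divisor} (hL : L.IsNonspecial) (s : C.Point → C.FunctionField)
    (hs : s.support.Finite) : ∃ f : C.FunctionField, ∀ P, L.HasPolesLE P (f - s P) := by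
  choose f hf hf' using fun P => exists_hasPolesLE_sub_single hL P (s P)
  classical
  have key : ∀ T : Finset C.Point, ∃ g : C.FunctionField, ∀ P,
      L.HasPolesLE P (g - if P ∈ T then s P else 0) := by
    intro T
    induction T using Finset.induction_on with
    | empty => exact ⟨0, fun P => Or.inl (by simp)⟩
    | insert Q T hQ ih =>
      obtain ⟨g, hg⟩ := ih
      refine ⟨g + f Q, fun P => ?_⟩
      rcases eq_or_ne P Q with rfl | hPQ
      · have h1 := hg P
        rw [if_neg hQ, sub_zero] at h1
        rw [if_pos (Finset.mem_insert_self _ _), add_sub_assoc]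
        exact h1.add (hf P)
      · have h1 := (hg P).add (hf' Q P hPQ)
        simp only [Finset.mem_insert, hPQ, false_or]
        rwa [add_sub_right_comm]
  obtain ⟨g, hg⟩ := key hs.toFinset
  refine ⟨g, fun P => ?_⟩
  have := hg P
  split_ifs at this with h
  · exact this
  · rw [Set.Finite.mem_toFinset, Function.mem_support, not_not] at h
    rwa [h]

/-- Multiplication by φ carries O(L) to O(K - A), which lies in O(K) because A is effective. -/
theorem exists_hasPolesLE_sub_of_linEquiv {L K A : C.Divisor} (hL : L.IsNonspecial)
    (hLK : L.LinEquiv (K - A)) (hA : 0 ≤ A) (s : C.Point → C.FunctionField)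
    (hs : s.support.Finite) : ∃ f : C.FunctionField, ∀ P, K.HasPolesLE P (f - s P) := by
  obtain ⟨φ, hφ, h⟩ := hLK
  obtain ⟨f, hf⟩ := exists_hasPolesLE_sub hL (fun P => s P / φ)
    (hs.subset fun P hP hP0 => hP (by simp [hP0]))
  refine ⟨f * φ, fun P => ?_⟩
  have hP : f * φ - s P = (f - s P / φ) * φ := by rw [sub_mul, div_mul_cancel₀ _ hφ]
  rcases hf P with h0 | h0
  · exact Or.inl (by rw [hP, h0, zero_mul])
  · rw [HasPolesLE, hP]
    by_cases hz : f - s P / φ = 0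
    · exact Or.inl (by rw [hz, zero_mul])
    right
    rw [C.ord_mul P hz hφ, ← h P]
    have := hA P
    simp only [Finsupp.coe_zero, Pi.zero_apply, Finsupp.coe_sub, Pi.sub_apply] at this ⊢
    linarith

end Divisor
end SmoothCurve

/-! ### Traces, derivations and finite extensions of k(x) -/

/-- The trace of a finite extension commutes with derivations. -/
theorem Algebra.trace_derivation {R K L : Type*} [CommRing R] [Field K] [Field L] [Algebra K L]
    [Algebra R L] [FiniteDimensional K L] (D : Derivation R L L) (D₀ : K → K)
    (h : ∀ c, D (algebraMap K L c) = algebraMap K L (D₀ c)) (g : L) :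
    Algebra.trace K L (D g) = D₀ (Algebra.trace K L g) := by
  classical
  have hadd : ∀ a b, D₀ (a + b) = D₀ a + D₀ b := fun a b =>
    (algebraMap K L).injective (by rw [map_add, ← h, ← h, ← h, map_add, map_add])
  let D₁ : K →+ K := AddMonoidHom.mk' D₀ hadd
  let b := Module.finBasis K L
  let M := Algebra.leftMulMatrix b g
  let N : Matrix _ _ K := Matrix.of fun i j => b.repr (D (b j)) i
  -- N records D on the basis. Multiplication by Dg is the commutator of D with multiplication by g;
  -- the matrix commutator N M - M N has trace zero.
  have key : Algebra.leftMulMatrix b (D g) = M.map D₁ + N * M - M * N := by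
    ext l j
    have h1 : g * b j = ∑ i, M i j • b i := by
      conv_lhs => rw [← b.sum_repr (g * b j)]
      simp only [M, Algebra.leftMulMatrix_eq_repr_mul]
    have h2 : D (g * b j) = ∑ i, (D₁ (M i j) • b i + M i j • D (b i)) := by
      rw [h1, map_sum]
      refine Finset.sum_congr rfl fun i _ => ?_
      rw [Algebra.smul_def, Derivation.leibniz, h, smul_eq_mul, smul_eq_mul, Algebra.smul_def,
        Algebra.smul_def, mul_comm (b i), add_comm]
      rfl
    have h3 : g * D (b j) = ∑ i, N i j • (g * b i) := by
      conv_lhs => rw [← b.sum_repr (D (b j)), Finset.mul_sum]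
      simp [N]
    have h4 : D g * b j = ∑ i, (D₁ (M i j) • b i + M i j • D (b i)) - ∑ i, N i j • (g * b i) := by
      rw [← h2, ← h3, Derivation.leibniz, smul_eq_mul, smul_eq_mul]
      ring
    rw [Algebra.leftMulMatrix_eq_repr_mul, h4]
    simp only [map_sub, map_sum, map_add, map_smul, Finset.sum_add_distrib, Finsupp.sub_apply,
      Finsupp.add_apply, Finsupp.finsetSum_apply, Finsupp.smul_apply, Module.Basis.repr_self,
      smul_eq_mul, Matrix.sub_apply, Matrix.add_apply, Matrix.map_apply, Matrix.mul_apply]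
    congr 1
    · congr 1
      · rw [Finset.sum_eq_single l] <;> simp +contextual
      · exact Finset.sum_congr rfl fun i _ => mul_comm _ _
    · refine Finset.sum_congr rfl fun i _ => ?_
      rw [mul_comm]
      simp only [M, Algebra.leftMulMatrix_eq_repr_mul]
  rw [Algebra.trace_eq_matrix_trace b, Algebra.trace_eq_matrix_trace b, key, Matrix.trace_sub,
    Matrix.trace_add, Matrix.trace_mul_comm N M, add_sub_cancel_right]
  exact (AddMonoidHom.map_trace D₁ M).symm

namespace Polynomial

theorem one_le_valuation_aeval {k L Γ : Type*} [Field k] [Field L] [Algebra k L]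
    [LinearOrderedCommGroupWithZero Γ] (v : Valuation L Γ)
    (hk : ∀ c : k, c ≠ 0 → v (algebraMap k L c) = 1) {x : L} (hx : 1 < v x) (p : k[X])
    (hp : p ≠ 0) : 1 ≤ v (aeval x p) := by
  -- Strictness for zero constant term drives the Horner induction: such a value dominates the
  -- constant, whose value is 1.
  suffices p ≠ 0 → 1 ≤ v (aeval x p) ∧ (p.coeff 0 = 0 → 1 < v (aeval x p)) from (this hp).1
  clear hp
  induction p using Polynomial.recOnHorner with
  | M0 => exact fun h => absurd rfl h
  | MC p a hp ha ih =>
    refine fun _ => ⟨?_, fun h => absurd h (by simpa [hp] using ha)⟩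
    rw [map_add, aeval_C]
    rcases eq_or_ne p 0 with rfl | hp0
    · rw [map_zero, zero_add, hk a ha]
    · have h1 := (ih hp0).2 hp
      rw [Valuation.map_add_eq_of_lt_left]
      · exact h1.le
      · rwa [hk a ha]
  | MX p hp ih =>
    intro _
    have h1 : 1 < v (aeval x (p * X)) := by
      rw [map_mul, aeval_X, map_mul]
      exact one_lt_mul (ih hp).1 hx
    exact ⟨h1.le, fun _ => h1⟩

end Polynomial

section
variable {k F : Type*} [Field k] [Field F] [Algebra k F]
open IntermediateField
open scoped IntermediateField.algebraAdjoinAdjoin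

theorem Derivation.apply_mem_adjoin (D : Derivation k F F) {x : F} (hx : D x = 1) {y : F}
    (hy : y ∈ Algebra.adjoin k {x}) : D y ∈ Algebra.adjoin k {x} := by
  induction hy using Algebra.adjoin_induction with
  | mem y hy => rw [Set.mem_singleton_iff.1 hy, hx]; exact one_mem _
  | algebraMap c => simp
  | add a b _ _ ha hb => rw [map_add]; exact add_mem ha hb
  | mul a b ha' hb' ha hb =>
    rw [leibniz]
    exact add_mem (mul_mem ha' hb) (mul_mem hb' ha)

theorem Derivation.apply_mem_intermediateField_adjoin (D : Derivation k F F) {x : F} (hx : D x = 1)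
    {y : F} (hy : y ∈ k⟮x⟯) : D y ∈ k⟮x⟯ := by
  induction hy using IntermediateField.adjoin_induction with
  | mem y hy => rw [Set.mem_singleton_iff.1 hy, hx]; exact one_mem _
  | algebraMap c => simp
  | add a b _ _ ha hb => rw [map_add]; exact add_mem ha hb
  | inv a ha' ha =>
    rw [leibniz_inv, smul_eq_mul]
    exact mul_mem (neg_mem (pow_mem (inv_mem ha') 2)) ha
  | mul a b ha' hb' ha hb =>
    rw [leibniz]
    exact add_mem (mul_mem ha' hb) (mul_mem hb' ha)

theorem isIntegrallyClosed_adjoin_of_transcendental {x : F} (hx : Transcendental k x) :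
    IsIntegrallyClosed (Algebra.adjoin k {x}) := by
  let e : Polynomial k ≃ₐ[k] Algebra.adjoin k {x} :=
    (AlgEquiv.ofInjective _ (transcendental_iff_injective.1 hx)).trans
      (Subalgebra.equivOfEq _ _ (Algebra.adjoin_singleton_eq_range_aeval k x).symm)
  exact IsIntegrallyClosed.of_equiv e.toRingEquiv

theorem trace_mem_adjoin_of_isIntegral {x : F} (hx : Transcendental k x)
    [FiniteDimensional k⟮x⟯ F] {a : F} (ha : IsIntegral (Algebra.adjoin k {x}) a) :
    (Algebra.trace k⟮x⟯ F a : F) ∈ Algebra.adjoin k {x} := by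
  have := isIntegrallyClosed_adjoin_of_transcendental hx
  have h := Algebra.isIntegral_trace (R := Algebra.adjoin k {x}) (L := k⟮x⟯) ha
  obtain ⟨p, hp⟩ := IsIntegrallyClosed.isIntegral_iff.1 h
  rw [← hp]
  exact p.2

/-- A rational differential `h dx` cannot have simple poles with residue that of `dx / x` at the
poles of `x` if elsewhere it is the sum of `a dx` and `dg` with `a` and `g` regular. -/
theorem not_forall_valuationSubring_mem_nonunits [CharZero k] {x : F} (hx : Transcendental k x)
    [FiniteDimensional k⟮x⟯ F] (D : Derivation k F F) (hD : D x = 1) {a g : F}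
    (ha : IsIntegral (Algebra.adjoin k {x}) a) (hg : IsIntegral (Algebra.adjoin k {x}) g)
    (h : ∀ V : ValuationSubring F, (∀ c : k, algebraMap k F c ∈ V) → x ∉ V →
      x * (a + D g) - 1 ∈ V.nonunits) : False := by
  let E := AlgebraicClosure F
  have : CharZero k⟮x⟯ := charZero_of_injective_algebraMap (algebraMap k k⟮x⟯).injective
  let x₀ : k⟮x⟯ := AdjoinSimple.gen k x
  set T := Algebra.trace k⟮x⟯ F (a + D g) with hT
  -- Tr(a + Dg) = Tr a + D(Tr g). Both traces lie in k[x], which is integrally closed and stable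
  -- under D since Dx = 1.
  obtain ⟨p, hp⟩ : ∃ p : Polynomial k, Polynomial.aeval x p = (T : F) := by
    rw [← AlgHom.mem_range, ← Algebra.adjoin_singleton_eq_range_aeval, hT, map_add,
      Algebra.trace_derivation D (fun c => ⟨D c, D.apply_mem_intermediateField_adjoin hD c.2⟩)
        fun c => rfl]
    exact add_mem (trace_mem_adjoin_of_isIntegral hx ha)
      (D.apply_mem_adjoin hD (trace_mem_adjoin_of_isIntegral hx hg))
  -- One place over x = ∞ of the algebraic closure is enough. Its pullback along each embedding of F
  -- over k(x) is a place of F where x has a pole, so every conjugate of x(a + Dg) - 1 is small, and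
  -- so is their sum, the trace.
  obtain ⟨W, hW, hxW⟩ : ∃ W : ValuationSubring E, (∀ c : k, algebraMap k E c ∈ W) ∧
      algebraMap F E x ∉ W := by
    have h1 : algebraMap F E x ∉ (integralClosure k E).toSubring := fun h1 =>
      hx ((isIntegral_algebraMap_iff (algebraMap F E).injective).1 h1).isAlgebraic
    obtain ⟨W, hW, hxW⟩ := Subring.exists_le_valuationSubring_of_isIntegrallyClosedIn h1
    exact ⟨W, fun c => hW (algebraMap_mem (integralClosure k E) c), hxW⟩
  have hWk : ∀ c : k, c ≠ 0 → W.valuation (algebraMap k E c) = 1 := fun c hc => by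
    have h1 := (W.valuation_le_one_iff _).2 (hW c)
    have h2 := (W.valuation_le_one_iff _).2 (hW c⁻¹)
    rw [map_inv₀, map_inv₀] at h2
    refine le_antisymm h1 ?_
    rwa [inv_le_one₀ (by simpa [zero_lt_iff] using hc)] at h2
  have hxv : 1 < W.valuation (algebraMap F E x) := by
    rw [← not_le, W.valuation_le_one_iff]
    exact hxW
  have hsum : W.valuation (algebraMap k⟮x⟯ E (Algebra.trace k⟮x⟯ F (x * (a + D g) - 1))) < 1 := by
    rw [trace_eq_sum_embeddings E]
    refine Valuation.map_sum_lt _ one_ne_zero fun σ _ => ?_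
    have hσx : σ x = algebraMap F E x := σ.commutes x₀
    have h1 := h (W.comap σ.toRingHom) (fun c => ?_) fun hV => hxW ?_
    · rw [← ValuationSubring.mem_nonunits_iff]
      rw [ValuationSubring.mem_nonunits_iff_or] at h1 ⊢
      refine h1.imp (fun h2 => by rw [h2, map_zero]) fun h2 h3 => h2 ?_
      rw [ValuationSubring.mem_comap]
      change σ _ ∈ W
      rwa [map_inv₀]
    · rw [ValuationSubring.mem_comap]
      change σ (algebraMap k⟮x⟯ F (algebraMap k k⟮x⟯ c)) ∈ W
      rw [σ.commutes]
      exact hW c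
    · rw [← hσx]
      exact hV
  have htr : Algebra.trace k⟮x⟯ F (x * (a + D g) - 1) = x₀ * T - Module.finrank k⟮x⟯ F := by
    have h1 : x * (a + D g) - 1 = x₀ • (a + D g) - algebraMap k⟮x⟯ F 1 := by
      rw [map_one]
      rfl
    rw [h1, map_sub, Algebra.trace_algebraMap, map_smul, smul_eq_mul, nsmul_one]
  have hn : (Module.finrank k⟮x⟯ F : k) ≠ 0 :=
    Nat.cast_ne_zero.2 Module.finrank_pos.ne'
  have h1 : algebraMap k⟮x⟯ E (Algebra.trace k⟮x⟯ F (x * (a + D g) - 1)) =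
      algebraMap F E x * Polynomial.aeval (algebraMap F E x) p -
        algebraMap k E (Module.finrank k⟮x⟯ F) := by
    rw [htr, map_sub, map_mul, map_natCast, map_natCast, Polynomial.aeval_algebraMap_apply, hp]
    rfl
  rw [h1] at hsum
  -- The trace is x p(x) - n with n = [F : k(x)] a nonzero constant, so x p(x) has the value of n.
  -- But x p(x) has value 0 if p = 0 and value > 1 otherwise.
  have h2 : W.valuation (algebraMap F E x * Polynomial.aeval (algebraMap F E x) p) = 1 := by
    have h3 := Valuation.map_add_eq_of_lt_right W.valuation (hsum.trans_eq (hWk _ hn).symm)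
    rw [sub_add_cancel] at h3
    rw [h3, hWk _ hn]
  rcases eq_or_ne p 0 with rfl | hp0
  · simp at h2
  · refine h2.not_gt ?_
    rw [map_mul]
    exact one_lt_mul_of_lt_of_le hxv (Polynomial.one_le_valuation_aeval W.valuation hWk hxv p hp0)

end

open IntermediateField in
/-- A field essentially of finite type over `k` whose differentials are generated by `dx` is finite
over `k(x)`. -/
theorem finiteDimensional_adjoin_of_span_D_eq_top {k F : Type*} [Field k] [Field F] [Algebra k F]
    [Algebra.EssFiniteType k F] {x : F}
    (h : Submodule.span F {KaehlerDifferential.D k F x} = ⊤) : FiniteDimensional k⟮x⟯ F := by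
  -- Over k(x) the generator dx dies, so the extension is unramified, and essential finite type
  -- makes it finite.
  have h1 : Subsingleton Ω[F⁄k⟮x⟯] := by
    refine ⟨fun a b => ?_⟩
    have h2 : ∀ a : Ω[F⁄k⟮x⟯], a = 0 := fun a => by
      obtain ⟨a, rfl⟩ := KaehlerDifferential.map_surjective k k⟮x⟯ F a
      obtain ⟨c, rfl⟩ := Submodule.mem_span_singleton.1 (h ▸ Submodule.mem_top : a ∈ _)
      rw [map_smul, KaehlerDifferential.map_D]
      have h3 : KaehlerDifferential.D k⟮x⟯ F (algebraMap k⟮x⟯ F (AdjoinSimple.gen k x)) = 0 :=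
        Derivation.map_algebraMap _ _
      exact (congrArg (c • ·) h3).trans (smul_zero c)
    rw [h2 a, h2 b]
  have : Algebra.FormallyUnramified k⟮x⟯ F := ⟨h1⟩
  have : Algebra.EssFiniteType k⟮x⟯ F := Algebra.EssFiniteType.of_comp k k⟮x⟯ F
  exact Algebra.FormallyUnramified.finite_of_free k⟮x⟯ F

/-! ### Local and global primitives; nonspecial O(K - A) -/

namespace SmoothCurve
variable {k : Type u} [Field k] [IsAlgClosed k] {C : SmoothCurve k}

omit [IsAlgClosed k] in
theorem ord_algebraMap_nonneg (P : C.Point) (c : k) :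
    0 ≤ C.ord P (algebraMap k C.FunctionField c) := by
  rcases eq_or_ne c 0 with rfl | hc
  · simp [ord_zero]
  · rw [C.ord_algebraMap P hc]

instance nonempty_point : Nonempty C.Point := by
  obtain ⟨x, -, hx⟩ := (isClosed_univ (X := C.X)).exists_closed_singleton ⟨genericPoint C.X, trivial⟩
  exact ⟨⟨x, hx⟩⟩

/-- The function field has a derivation that comes from a generator `dx` of its differentials, and
is finite over `k(x)`. -/
theorem exists_derivation [Nontrivial Ω[C.FunctionField⁄k]] : ∃ (x : C.FunctionField)
    (ℓ : Ω[C.FunctionField⁄k] →ₗ[C.FunctionField] C.FunctionField),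
    Function.Injective ℓ ∧ ℓ (KaehlerDifferential.D k _ x) = 1 ∧
      FiniteDimensional (IntermediateField.adjoin k {x}) C.FunctionField := by
  obtain ⟨P⟩ : Nonempty C.Point := inferInstance
  obtain ⟨t, ht⟩ := exists_irreducible_stalk P
  set x := algebraMap _ C.FunctionField t
  have hspan := span_D_functionField_eq_top P ht
  have hx : KaehlerDifferential.D k C.FunctionField x ≠ 0 := fun h => by
    rw [h, Submodule.span_zero_singleton] at hspan
    exact bot_ne_top hspan
  obtain ⟨ℓ, hℓ⟩ := Module.Projective.exists_dual_eq_one C.FunctionField hx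
  refine ⟨x, ℓ, (injective_iff_map_eq_zero ℓ).2 fun η hη => ?_, hℓ, ?_⟩
  · obtain ⟨c, rfl⟩ := Submodule.mem_span_singleton.1 (hspan ▸ Submodule.mem_top : η ∈ _)
    rw [map_smul, hℓ, smul_eq_mul, mul_one] at hη
    rw [hη, zero_smul]
  · have : Algebra.EssFiniteType k C.FunctionField := essFiniteType_stalk (genericPoint C.X)
    exact finiteDimensional_adjoin_of_span_D_eq_top hspan

/-- An integrally closed subring is the intersection of the valuation rings above it. One that
contains k[x] but not y would be the local ring at a point where x is regular and y is not. -/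
theorem isIntegral_adjoin {x y : C.FunctionField}
    (h : ∀ P : C.Point, 0 ≤ C.ord P x → 0 ≤ C.ord P y) :
    IsIntegral (Algebra.adjoin k {x}) y := by
  by_contra hy
  have h1 : y ∉ (integralClosure (Algebra.adjoin k {x}) C.FunctionField).toSubring := hy
  obtain ⟨V, hV, hyV⟩ := Subring.exists_le_valuationSubring_of_isIntegrallyClosedIn h1
  have hA : ∀ z ∈ Algebra.adjoin k {x}, z ∈ V := fun z hz =>
    hV (algebraMap_mem (integralClosure (Algebra.adjoin k {x}) C.FunctionField) ⟨z, hz⟩)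
  obtain ⟨P, hP⟩ := exists_point_of_valuationSubring V
    (fun c => hA _ (algebraMap_mem _ c)) (fun e => hyV (e ▸ trivial))
  exact hyV ((hP y).2 (h P ((hP x).1 (hA x (Algebra.self_mem_adjoin_singleton k x)))))

/-- There is a polynomial in `x` that vanishes to a given order at given points. -/
theorem exists_le_ord {x : C.FunctionField} (hx : ∀ c : k, x ≠ algebraMap k _ c)
    (T : Finset C.Point) (hT : ∀ P ∈ T, 0 ≤ C.ord P x) (m : ℕ) :
    ∃ q : C.FunctionField, q ≠ 0 ∧ (∀ P, 0 ≤ C.ord P x → 0 ≤ C.ord P q) ∧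
      ∀ P ∈ T, m ≤ C.ord P q := by
  choose! c hc using fun P hP => exists_ord_sub_algebraMap_pos P (hT P hP)
  have hc' : ∀ P ∈ T, 0 < C.ord P (x - algebraMap k _ (c P)) := fun P hP =>
    (hc P hP).resolve_left (hx _)
  have h0 : ∀ a : k, x - algebraMap k _ a ≠ 0 := fun a => sub_ne_zero.2 (hx a)
  have hreg : ∀ (a : k) (P : C.Point), 0 ≤ C.ord P x → 0 ≤ C.ord P (x - algebraMap k _ a) := by
    intro a P hP
    rw [sub_eq_add_neg, ← map_neg]
    refine ord_add_nonneg P hP ?_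
    exact ord_algebraMap_nonneg P _
  refine ⟨∏ P ∈ T, (x - algebraMap k _ (c P)) ^ m, Finset.prod_ne_zero_iff.2
    fun P _ => pow_ne_zero _ (h0 _), fun P hP => ?_, fun P hP => ?_⟩
  · refine Finset.prod_induction _ (fun y => 0 ≤ C.ord P y) (fun _ _ => ord_mul_nonneg P)
      (ord_one P).ge fun Q _ => ?_
    rw [ord_pow P (h0 _)]
    have := hreg (c Q) P hP
    positivity
  · classical
    rw [← Finset.mul_prod_erase T _ hP, C.ord_mul P (pow_ne_zero _ (h0 _))
      (Finset.prod_ne_zero_iff.2 fun P _ => pow_ne_zero _ (h0 _)), ord_pow P (h0 _)]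
    have h1 : 0 ≤ C.ord P (∏ Q ∈ T.erase P, (x - algebraMap k _ (c Q)) ^ m) := by
      refine Finset.prod_induction _ (fun y => 0 ≤ C.ord P y) (fun _ _ => ord_mul_nonneg P)
        (ord_one P).ge fun Q _ => ?_
      rw [ord_pow P (h0 _)]
      have := hreg (c Q) P (hT P hP)
      positivity
    have h2 := hc' P hP
    nlinarith

section Local
variable (D : Derivation k C.FunctionField C.FunctionField) (P : C.Point) {t : C.FunctionField}

/-- Termwise integration: in characteristic zero a function regular at a point is a derivative with
respect to a local parameter, to any given order. -/
theorem exists_ord_sub_div_nonneg [CharZero k] (ht : C.ord P t = 1) (hDt : D t ≠ 0)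
    {u : C.FunctionField} (hu : 0 ≤ C.ord P u) (N : ℕ) :
    ∃ g, 0 ≤ C.ord P g ∧ 0 ≤ C.ord P ((u - D g / D t) / t ^ N) := by
  have ht0 : t ≠ 0 := by rintro rfl; simp [ord_zero] at ht
  induction N with
  | zero => exact ⟨0, (ord_zero P).ge, by simpa using hu⟩
  | succ N ih =>
    obtain ⟨g, hg, hr⟩ := ih
    obtain ⟨c, hc⟩ := exists_ord_sub_algebraMap_pos P hr
    have hN : (algebraMap k C.FunctionField (N + 1 : k)) ≠ 0 := by
      rw [map_ne_zero_iff _ (algebraMap k C.FunctionField).injective]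
      exact Nat.cast_add_one_ne_zero N
    -- The new term has derivative c tᴺ Dt, which removes the leading coefficient c of the
    -- remainder. Dividing by N + 1 needs characteristic zero.
    refine ⟨g + algebraMap k _ (c / (N + 1)) * t ^ (N + 1), ord_add_nonneg P hg
      (ord_mul_nonneg P (ord_algebraMap_nonneg P _) ?_), ?_⟩
    · rw [ord_pow P ht0, ht]; positivity
    · have h1 : (u - D (g + algebraMap k _ (c / (N + 1)) * t ^ (N + 1)) / D t) / t ^ (N + 1) =
          ((u - D g / D t) / t ^ N - algebraMap k _ c) / t := by
        rw [map_add, Derivation.leibniz, Derivation.map_algebraMap, Derivation.leibniz_pow,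
          map_div₀]
        rw [map_add, map_natCast, map_one] at hN ⊢
        simp only [smul_eq_mul, nsmul_eq_mul, Nat.add_sub_cancel, mul_zero, add_zero]
        push_cast
        field_simp
        ring
      rw [h1]
      rcases hc with hc | hc
      · rw [hc, sub_self, zero_div, ord_zero]
      · rw [ord_div P (by rintro h; rw [h, ord_zero] at hc; exact lt_irrefl _ hc) ht0, ht]
        linarith

variable {D P}
variable (ht : C.ord P t = 1) (hD : ∀ g, 0 ≤ C.ord P g → 0 ≤ C.ord P (D g / D t))
include ht hD

/-- D is Dt times d/dt. If Dt has a pole of order M > 0, a zero of order M + 1 of g loses one order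
under d/dt and still cancels the pole. -/
theorem ord_derivation_nonneg (hDt : D t ≠ 0) {g : C.FunctionField} (hg : 0 ≤ C.ord P g)
    (hg' : C.ord P (D t) < 0 → 1 - C.ord P (D t) ≤ C.ord P g) : 0 ≤ C.ord P (D g) := by
  have ht0 : t ≠ 0 := by rintro rfl; simp [ord_zero] at ht
  rcases le_or_gt 0 (C.ord P (D t)) with h | h
  · rw [← div_mul_cancel₀ (D g) hDt]
    exact ord_mul_nonneg P (hD g hg) h
  obtain ⟨M, hM⟩ := Int.eq_ofNat_of_zero_le (neg_nonneg.2 h.le)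
  have hpow : t ^ (M + 1) ≠ 0 := pow_ne_zero _ ht0
  obtain ⟨v, rfl, hv⟩ : ∃ v, g = v * t ^ (M + 1) ∧ 0 ≤ C.ord P v := by
    refine ⟨g / t ^ (M + 1), (div_mul_cancel₀ g hpow).symm, ?_⟩
    rcases eq_or_ne g 0 with rfl | hg0
    · simp [ord_zero]
    rw [ord_div P hg0 hpow, ord_pow P ht0, ht]
    have := hg' h
    push_cast
    linarith
  have h1 : D (v * t ^ (M + 1)) = t ^ M * D t * ((M + 1 : ℕ) • v + t * (D v / D t)) := by
    rw [Derivation.leibniz, Derivation.leibniz_pow]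
    simp only [smul_eq_mul, nsmul_eq_mul, Nat.add_sub_cancel]
    field_simp
    ring
  rw [h1]
  refine ord_mul_nonneg P ?_ (ord_add_nonneg P ?_ (ord_mul_nonneg P (by rw [ht]; norm_num)
    (hD v hv)))
  · rw [C.ord_mul P (pow_ne_zero _ ht0) hDt, ord_pow P ht0, ht]
    linarith
  · rw [nsmul_eq_mul, ← map_natCast (algebraMap k C.FunctionField)]
    refine ord_mul_nonneg P (ord_algebraMap_nonneg P _) hv

/-- The differential `dx` has a pole of order at least `n + 1` where `x` has a pole of order `n`. -/
theorem one_sub_ord_le_ord_derivation [CharZero k] {x : C.FunctionField} (hx : C.ord P x < 0)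
    (hDx : D x = 1) (hDt : D t ≠ 0) : 1 - C.ord P x ≤ C.ord P (D t) := by
  have ht0 : t ≠ 0 := by rintro rfl; simp [ord_zero] at ht
  have hx0 : x ≠ 0 := by rintro rfl; simp [ord_zero] at hx
  obtain ⟨m, hm⟩ := Int.eq_ofNat_of_zero_le (neg_nonneg.2 hx.le)
  obtain ⟨n, rfl⟩ : ∃ n, m = n + 1 := Nat.exists_eq_succ_of_ne_zero (by rintro rfl; simp at hm; omega)
  have hpow : t ^ (n + 1) ≠ 0 := pow_ne_zero _ ht0
  have hv : 0 ≤ C.ord P (x * t ^ (n + 1)) := by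
    rw [C.ord_mul P hx0 hpow, ord_pow P ht0, ht]
    linarith
  have hu := hD _ hv
  set u := D (x * t ^ (n + 1)) / D t with hu'
  -- Leibniz applied to x tⁿ⁺¹ with Dx = 1. Here x has a pole of order n + 1, so x tⁿ has a simple
  -- pole, which the regular u cannot cancel; n + 1 ≠ 0 in k is essential.
  have h1 : t ^ (n + 1) = D t * (u - (n + 1 : ℕ) • (x * t ^ n)) := by
    rw [mul_sub, hu', mul_div_cancel₀ _ hDt, Derivation.leibniz, Derivation.leibniz_pow, hDx]
    simp only [smul_eq_mul, nsmul_eq_mul, Nat.add_sub_cancel]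
    ring
  have hw : u - (n + 1 : ℕ) • (x * t ^ n) ≠ 0 := fun h => hpow (by rw [h1, h, mul_zero])
  have h2 : C.ord P (t ^ (n + 1)) = C.ord P (D t) + C.ord P (u - (n + 1 : ℕ) • (x * t ^ n)) := by
    conv_lhs => rw [h1]
    exact C.ord_mul P hDt hw
  rw [ord_pow P ht0, ht] at h2
  by_contra hcon
  have h3 : 0 ≤ C.ord P (u - (n + 1 : ℕ) • (x * t ^ n)) := by linarith
  have h4 : 0 ≤ C.ord P ((n + 1 : ℕ) • (x * t ^ n)) := by
    have := ord_add_nonneg P hu ((C.ord_neg P _).ge.trans' h3)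
    rwa [neg_sub, add_sub_cancel] at this
  have hn : ((n + 1 : ℕ) : k) ≠ 0 := Nat.cast_ne_zero.2 n.succ_ne_zero
  rw [nsmul_eq_mul, ← map_natCast (algebraMap k C.FunctionField), C.ord_mul P
    (by simpa only [map_ne_zero] using hn) (mul_ne_zero hx0 (pow_ne_zero _ ht0)),
    C.ord_algebraMap P hn, C.ord_mul P hx0 (pow_ne_zero _ ht0), ord_pow P ht0, ht] at h4
  push_cast at hm
  linarith

end Local

namespace Divisor

/-- On a nonspecial line bundle isomorphic to `O(K - A)` the divisor `A` is not effective. -/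
theorem IsNonspecial.not_nonneg [CharZero k] {L K A : C.Divisor} (hL : L.IsNonspecial)
    (hK : K.IsCanonical) (hLK : L.LinEquiv (K - A)) : ¬ 0 ≤ A := by
  intro hA
  obtain ⟨ω, hω, hωK⟩ := hK
  have hnt : Nontrivial Ω[C.FunctionField⁄k] := ⟨ω, 0, hω⟩
  obtain ⟨x, ℓ, hℓ, hx, hfin⟩ := exists_derivation (C := C)
  let D : Derivation k C.FunctionField C.FunctionField :=
    ℓ.compDer (KaehlerDifferential.D k C.FunctionField)
  have hDℓ : ∀ y, D y = ℓ (KaehlerDifferential.D k C.FunctionField y) := fun _ => rfl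
  have hDx : D x = 1 := hx
  have hxk : ∀ c : k, x ≠ algebraMap k _ c := by
    rintro c rfl
    rw [D.map_algebraMap] at hDx
    exact zero_ne_one hDx
  have hx0 : x ≠ 0 := by simpa using hxk 0
  have htr : Transcendental k x := fun h => by
    obtain ⟨c, hc⟩ := minpoly.mem_range_of_degree_eq_one k x
      (IsAlgClosed.degree_eq_one_of_irreducible k (minpoly.irreducible h.isIntegral))
    exact hxk c hc.symm
  let w := ℓ ω
  have hw : w ≠ 0 := fun h => hω (hℓ (by rw [map_zero]; exact h))
  -- Since ω = w dx = f dt locally, w = f Dt and ord f = K P; this ties the canonical divisor to the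
  -- order of Dt.
  have hloc : ∀ P : C.Point, ∃ t : C.FunctionField, C.ord P t = 1 ∧ D t ≠ 0 ∧
      C.ord P (D t) = C.ord P w - K P ∧ ∀ g, 0 ≤ C.ord P g → 0 ≤ C.ord P (D g / D t) := by
    intro P
    obtain ⟨t, f, ht, hf, hfK⟩ := hωK P
    have h1 : w = f * D (algebraMap _ C.FunctionField t) := by
      rw [hDℓ, ← smul_eq_mul, ← map_smul, ← hf]
    have hf0 := left_ne_zero_of_mul (h1 ▸ hw)
    have hDt := right_ne_zero_of_mul (h1 ▸ hw)
    refine ⟨algebraMap _ _ t, ord_irreducible P ht, hDt, ?_, fun g hg => ?_⟩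
    · rw [h1, C.ord_mul P hf0 hDt, hfK]
      ring
    · obtain ⟨u, hu, hg⟩ := exists_D_eq_smul_D P ht hg
      have h2 : D g = u * D (algebraMap _ C.FunctionField t) := by
        rw [hDℓ, hDℓ, hg, map_smul, smul_eq_mul]
      rwa [h2, mul_div_cancel_right₀ _ hDt]
  choose t ht hDt hord hreg using hloc
  have hAD := exists_hasPolesLE_sub_of_linEquiv hL hLK hA
  classical
  -- a function `h` such that `h dx` has the principal part of `dx / x` at the poles of `x`
  obtain ⟨f, hf⟩ := hAD (fun P => if C.ord P x < 0 then (x * w)⁻¹ else 0)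
    ((finite_setOf_ord_ne_zero hx0).subset fun P hP => by
      simp only [Function.mem_support, ne_eq, ite_eq_right_iff, not_forall] at hP
      exact hP.1.ne)
  let h := w * f
  -- h dx = f ω agrees with dx/x up to a regular differential, so ord(xh - 1) ≥ ord x + ord w - K P
  -- = ord x + ord(Dt) ≥ 1.
  have hpole : ∀ P, C.ord P x < 0 → x * h - 1 = 0 ∨ 0 < C.ord P (x * h - 1) := by
    intro P hP
    have h1 := hf P
    rw [if_pos hP] at h1
    have h2 : x * h - 1 = x * w * (f - (x * w)⁻¹) := by
      rw [mul_sub, mul_inv_cancel₀ (mul_ne_zero hx0 hw)]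
      ring
    rw [h2]
    by_cases h3 : f - (x * w)⁻¹ = 0
    · exact Or.inl (by rw [h3, mul_zero])
    right
    rw [C.ord_mul P (mul_ne_zero hx0 hw) h3, C.ord_mul P hx0 hw]
    have h4 := one_sub_ord_le_ord_derivation (ht P) (hreg P) hP hDx (hDt P)
    rw [hord] at h4
    have h5 := h1.resolve_left h3
    linarith
  have hh : ∀ P, 0 ≤ C.ord P x → 0 ≤ C.ord P (h / D (t P)) := by
    intro P hP
    have h1 := hf P
    rw [if_neg hP.not_gt, sub_zero] at h1
    rcases eq_or_ne f 0 with h0 | h0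
    · simp [h, h0, ord_zero]
    rw [ord_div P (mul_ne_zero hw h0) (hDt P), C.ord_mul P hw h0, hord]
    have h2 := h1.resolve_left h0
    linarith
  -- local primitives of the principal parts of `h dx` modulo regular multiples of `dx`
  have hprim : ∀ P, ∃ g, 0 ≤ C.ord P g ∧ (0 ≤ C.ord P x → 0 ≤ C.ord P (h - D g)) ∧
      (0 ≤ C.ord P h → g = 0) := by
    intro P
    by_cases h0 : 0 ≤ C.ord P h
    · exact ⟨0, (ord_zero P).ge, fun _ => by simpa using h0, fun _ => rfl⟩
    by_cases hP : 0 ≤ C.ord P x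
    -- h dx is regular here, but h may have a pole from that of Dt (ramification of x). Integrating
    -- to the order of that pole makes h - Dg regular.
    · obtain ⟨g, hg, hg'⟩ := exists_ord_sub_div_nonneg D P (ht P) (hDt P) (hh P hP)
        (-C.ord P (D (t P))).toNat
      refine ⟨g, hg, fun _ => ?_, fun h1 => absurd h1 h0⟩
      have ht0 : t P ≠ 0 := by
        intro h1
        have := ht P
        simp [h1, ord_zero] at this
      have h1 : h - D g = (h / D (t P) - D g / D (t P)) /
          t P ^ (-C.ord P (D (t P))).toNat * (t P ^ (-C.ord P (D (t P))).toNat * D (t P)) := by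
        have := hDt P
        field_simp
      rw [h1]
      refine ord_mul_nonneg P hg' ?_
      rw [C.ord_mul P (pow_ne_zero _ ht0) (hDt P), ord_pow P ht0, ht]
      have := Int.self_le_toNat (-C.ord P (D (t P)))
      linarith
    · exact ⟨0, (ord_zero P).ge, fun h1 => absurd h1 hP, fun _ => rfl⟩
  choose γ hγ hγh hγ0 using hprim
  -- a global primitive
  let B : C.Point → ℤ := fun P => K P + if C.ord P (D (t P)) < 0 then 1 - C.ord P (D (t P)) else 0
  have hBfin : {P | 0 ≤ C.ord P x ∧ 0 < B P}.Finite := by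
    refine (K.support.finite_toSet.union (finite_setOf_ord_ne_zero hw)).subset fun P hP => ?_
    by_contra hcon
    simp only [Set.mem_union, Finset.mem_coe, Finsupp.mem_support_iff, ne_eq, Set.mem_ofPred_eq,
      not_or, not_not] at hcon
    have h1 := hP.2
    simp only [B, hord, hcon.1, hcon.2] at h1
    norm_num at h1
  obtain ⟨m, hm⟩ : ∃ m : ℕ, ∀ P ∈ hBfin.toFinset, B P ≤ m := by
    refine ⟨∑ P ∈ hBfin.toFinset, (B P).toNat, fun P hP => (Int.self_le_toNat _).trans ?_⟩
    exact_mod_cast Finset.single_le_sum (f := fun P => (B P).toNat) (fun _ _ => Nat.zero_le _) hP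
  -- Principal parts are realized only modulo O(K), so γ/q is approximated and the result multiplied
  -- by q. In `B`, the summand K P absorbs the poles O(K) allows, and the other is the vanishing
  -- that keeps D(g - γ) regular. Poles of g over x = ∞ are harmless.
  obtain ⟨q, hq0, hq, hqm⟩ := exists_le_ord hxk hBfin.toFinset
    (fun P hP => ((Set.Finite.mem_toFinset _).1 hP).1) m
  have hqB : ∀ P, 0 ≤ C.ord P x → B P ≤ C.ord P q := by
    intro P hP
    by_cases h1 : 0 < B P
    · have h2 : P ∈ hBfin.toFinset := (Set.Finite.mem_toFinset _).2 ⟨hP, h1⟩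
      exact (hm P h2).trans (hqm P h2)
    · exact (not_lt.1 h1).trans (hq P hP)
  have hγfin : γ.support.Finite := by
    by_cases hh0 : h = 0
    · refine Set.finite_empty.subset fun P hP => hP (hγ0 P ?_)
      rw [hh0, ord_zero]
    · exact (finite_setOf_ord_ne_zero hh0).subset fun P hP h1 => hP (hγ0 P h1.ge)
  obtain ⟨f', hf'⟩ := hAD (fun P => γ P / q) (hγfin.subset fun P hP h1 => hP (by simp [h1]))
  let g := q * f'
  have hdiff : ∀ P, 0 ≤ C.ord P x → g - γ P = 0 ∨ B P - K P ≤ C.ord P (g - γ P) := by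
    intro P hP
    have h1 : g - γ P = q * (f' - γ P / q) := by rw [mul_sub, mul_div_cancel₀ _ hq0]
    rw [h1]
    by_cases h2 : f' - γ P / q = 0
    · exact Or.inl (by rw [h2, mul_zero])
    right
    rw [C.ord_mul P hq0 h2]
    have h3 := (hf' P).resolve_left h2
    have h4 := hqB P hP
    linarith
  have hBK : ∀ P, 0 ≤ B P - K P := by
    intro P
    simp only [B, add_sub_cancel_left]
    split_ifs <;> omega
  have hdiff0 : ∀ P, 0 ≤ C.ord P x → 0 ≤ C.ord P (g - γ P) := by
    intro P hP
    rcases hdiff P hP with h1 | h1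
    · rw [h1, ord_zero]
    · exact (hBK P).trans h1
  have hg : ∀ P, 0 ≤ C.ord P x → 0 ≤ C.ord P g := by
    intro P hP
    rw [← sub_add_cancel g (γ P)]
    exact ord_add_nonneg P (hdiff0 P hP) (hγ P)
  have ha : ∀ P, 0 ≤ C.ord P x → 0 ≤ C.ord P (h - D g) := by
    intro P hP
    have h1 : h - D g = h - D (γ P) + -D (g - γ P) := by rw [map_sub]; ring
    rw [h1]
    refine ord_add_nonneg P (hγh P hP) ?_
    rw [C.ord_neg]
    rcases hdiff P hP with h2 | h2
    · rw [h2, map_zero, ord_zero]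
    · refine ord_derivation_nonneg (ht P) (hreg P) (hDt P) (hdiff0 P hP) fun h3 => ?_
      simpa only [B, add_sub_cancel_left, if_pos h3] using h2
  refine not_forall_valuationSubring_mem_nonunits htr D hDx (isIntegral_adjoin ha)
    (isIntegral_adjoin hg) fun V hV hxV => ?_
  obtain ⟨P, hP⟩ := exists_point_of_valuationSubring V hV (fun e => hxV (e ▸ trivial))
  rw [sub_add_cancel, ValuationSubring.mem_nonunits_iff_or]
  refine (hpole P (not_le.1 fun h1 => hxV ((hP x).2 h1))).imp_right fun h1 h2 => ?_
  have h3 := (hP _).1 h2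
  rw [ord_inv] at h3
  linarith

end Divisor
end SmoothCurve

/-! ### Divisors, linear equivalence and linear systems -/

namespace SmoothCurve
variable {k : Type u} [Field k] {C : SmoothCurve k}

namespace Divisor

theorem deg_add (D E : C.Divisor) : (D + E).deg = D.deg + E.deg :=
  Finsupp.sum_add_index' (fun _ => rfl) fun _ _ _ => rfl

theorem deg_sub (D E : C.Divisor) : (D - E).deg = D.deg - E.deg := by
  rw [eq_sub_iff_add_eq, ← deg_add, sub_add_cancel]

theorem deg_nonneg {D : C.Divisor} (hD : 0 ≤ D) : 0 ≤ D.deg :=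
  Finset.sum_nonneg fun P _ => hD P

theorem deg_le_deg {D E : C.Divisor} (h : D ≤ E) : D.deg ≤ E.deg := by
  have := deg_nonneg (sub_nonneg.2 h)
  rw [deg_sub] at this
  linarith

theorem deg_single (P : C.Point) (n : ℤ) : deg (Finsupp.single P n : C.Divisor) = n :=
  Finsupp.sum_single_index rfl

theorem LinEquiv.symm {D E : C.Divisor} (h : D.LinEquiv E) : E.LinEquiv D := by
  obtain ⟨f, hf, h⟩ := h
  exact ⟨f⁻¹, inv_ne_zero hf, fun P => by rw [ord_inv, ← h]; ring⟩

theorem LinEquiv.trans {D E F : C.Divisor} (h : D.LinEquiv E) (h' : E.LinEquiv F) :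
    D.LinEquiv F := by
  obtain ⟨f, hf, h⟩ := h
  obtain ⟨g, hg, h'⟩ := h'
  exact ⟨f * g, mul_ne_zero hf hg, fun P => by rw [C.ord_mul P hf hg, ← h, ← h']; ring⟩

theorem LinEquiv.of_sub_eq {D E D' E' : C.Divisor} (h : D.LinEquiv E) (h' : D - E = D' - E') :
    D'.LinEquiv E' := by
  obtain ⟨f, hf, h⟩ := h
  exact ⟨f, hf, fun P => by rw [← h P, ← Finsupp.sub_apply, ← h', Finsupp.sub_apply]⟩

variable [IsAlgClosed k]

theorem mem_globalSections_iff {D : C.Divisor} {f : C.FunctionField} (hf : f ≠ 0) :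
    f ∈ D.globalSections ↔ ∀ P, 0 ≤ D P + C.ord P f := by
  refine forall_congr' fun P => ?_
  rw [HasPolesLE, or_iff_right hf]
  constructor <;> intro h <;> linarith

theorem globalSections_mono {D E : C.Divisor} (h : D ≤ E) :
    D.globalSections ≤ E.globalSections := fun _ hf P =>
  (hf P).imp_right fun h1 => (neg_le_neg (h P)).trans h1

theorem algebraMap_mem_globalSections {D : C.Divisor} (hD : 0 ≤ D) (c : k) :
    algebraMap k C.FunctionField c ∈ D.globalSections := fun P =>
  Or.inr ((neg_nonpos.2 (hD P)).trans (ord_algebraMap_nonneg P c))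

theorem h0_eq_one_iff {D : C.Divisor} (hD : 0 ≤ D) :
    D.h0 = 1 ↔ ∀ f ∈ D.globalSections, ∃ c : k, f = algebraMap k C.FunctionField c := by
  let v : D.globalSections := ⟨algebraMap k C.FunctionField 1, algebraMap_mem_globalSections hD 1⟩
  have hv : v ≠ 0 := fun h => by simpa [v] using congrArg Subtype.val h
  have hsmul : ∀ c : k, ((c • v : D.globalSections) : C.FunctionField) = algebraMap k _ c :=
    fun c => by simp [v, Algebra.smul_def]
  refine (finrank_eq_one_iff_of_nonzero' v hv).trans
    ⟨fun h f hf => ?_, fun h w => ?_⟩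
  · obtain ⟨c, hc⟩ := h ⟨f, hf⟩
    exact ⟨c, by rw [← hsmul, hc]⟩
  · obtain ⟨c, hc⟩ := h w.1 w.2
    exact ⟨c, Subtype.ext ((hsmul c).trans hc.symm)⟩

/-- The divisor of a nonzero rational function. -/
theorem exists_apply_eq_ord {f : C.FunctionField} (hf : f ≠ 0) :
    ∃ D : C.Divisor, ∀ P, D P = C.ord P f :=
  ⟨Finsupp.ofSupportFinite _ (finite_setOf_ord_ne_zero hf), fun _ => rfl⟩

theorem IsCompleteGrd.mem_of_linEquiv {g : Set C.Divisor} {r : ℕ} {d : ℤ} (hg : IsCompleteGrd g r d)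
    {D E : C.Divisor} (hD : D ∈ g) (hE : 0 ≤ E) (h : E.LinEquiv D) : E ∈ g := by
  rw [(hg.2 D hD).1]
  exact ⟨hE, h⟩

theorem IsCompleteGrd.nonneg {g : Set C.Divisor} {r : ℕ} {d : ℤ} (hg : IsCompleteGrd g r d)
    {D : C.Divisor} (hD : D ∈ g) : 0 ≤ D := by
  have h := hD
  rw [(hg.2 D hD).1] at h
  exact h.1

theorem IsCompleteGrd.linEquiv {g : Set C.Divisor} {r : ℕ} {d : ℤ} (hg : IsCompleteGrd g r d)
    {D E : C.Divisor} (hD : D ∈ g) (hE : E ∈ g) : D.LinEquiv E := by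
  rw [(hg.2 E hE).1] at hD
  exact hD.2

/-- If `h⁰` does not change on adding an effective divisor `F`, then every divisor in `|D + F|`
contains `F`. -/
theorem le_of_linEquiv_add {D E F : C.Divisor} (hF : 0 ≤ F) (h : (D + F).h0 = D.h0)
    (hpos : D.h0 ≠ 0) (hE : 0 ≤ E) (hEF : E.LinEquiv (D + F)) : F ≤ E := by
  obtain ⟨f, hf, hE'⟩ := hEF
  -- A `finrank` of 0 could also mean infinite dimension; being nonzero, it gives finiteness, so
  -- equal ranks force equal spaces.
  have : FiniteDimensional k (D + F).globalSections :=
    Module.finite_of_finrank_pos (Nat.pos_of_ne_zero fun h0 => hpos (h.symm.trans h0))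
  have heq := Submodule.eq_of_le_of_finrank_eq
    (globalSections_mono (le_add_of_nonneg_right hF : D ≤ D + F)) h.symm
  have h1 : f ∈ (D + F).globalSections := (mem_globalSections_iff hf).2 fun P => by
    have := hE P
    rw [← hE' P]
    simpa using this
  rw [← heq, mem_globalSections_iff hf] at h1
  intro P
  have h2 := h1 P
  rw [← hE' P, Finsupp.add_apply] at h2
  linarith

/-- If `gcd(ξ, D)` has maximal degree among the divisors of a complete linear system and is not `ξ`,
then `D - gcd(ξ, D)` does not move. -/
theorem h0_sub_inf_eq_one {g : Set C.Divisor} {r : ℕ} {d : ℤ} (hg : IsCompleteGrd g r d)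
    {ξ D : C.Divisor} (hξ : 0 ≤ ξ) (hD : D ∈ g) (hmax : ∀ D' ∈ g, (ξ ⊓ D').deg ≤ (ξ ⊓ D).deg)
    (hne : ξ - ξ ⊓ D ≠ 0) : (D - ξ ⊓ D).h0 = 1 := by
  have hD0 := hg.nonneg hD
  have hA : 0 ≤ D - ξ ⊓ D := sub_nonneg.2 inf_le_right
  rw [h0_eq_one_iff hA]
  intro f hf
  obtain ⟨P, hP⟩ := Finsupp.ne_iff.1 hne
  simp only [Finsupp.coe_sub, Finsupp.inf_apply, Pi.sub_apply, Finsupp.coe_zero,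
    Pi.zero_apply] at hP
  -- At a point P of ξ - (ξ,D) the divisor D - (ξ,D) has coefficient zero, so f has a value c there.
  -- If f ≠ c, the zero of f - c at P moves D to a member of the system whose gcd with ξ contains
  -- (ξ,D) + P.
  have hPlt : D P < ξ P := by
    by_contra h
    exact hP (by rw [inf_eq_left.2 (not_lt.1 h), sub_self])
  have hAP : (D - ξ ⊓ D) P = 0 := by
    simp [inf_eq_right.2 hPlt.le]
  have hreg : 0 ≤ C.ord P f := by
    rcases hf P with h | h
    · rw [h, ord_zero]
    · rwa [hAP, neg_zero] at h
  obtain ⟨c, hc⟩ := exists_ord_sub_algebraMap_pos P hreg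
  refine ⟨c, hc.resolve_right fun hpos => ?_⟩
  set φ := f - algebraMap k C.FunctionField c
  have hφ0 : φ ≠ 0 := by
    intro h
    rw [h, ord_zero] at hpos
    exact lt_irrefl _ hpos
  have hφ : φ ∈ (D - ξ ⊓ D).globalSections :=
    sub_mem hf (algebraMap_mem_globalSections hA c)
  rw [mem_globalSections_iff hφ0] at hφ
  obtain ⟨Δ, hΔ⟩ := exists_apply_eq_ord hφ0
  have hge : ξ ⊓ D + Finsupp.single P 1 ≤ D + Δ := by
    intro Q
    have h1 := hφ Q
    rw [← hΔ Q] at h1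
    rcases eq_or_ne Q P with rfl | hQ
    · rw [← hΔ Q] at hpos
      simp only [Finsupp.add_apply, Finsupp.inf_apply, Finsupp.single_eq_same,
        inf_eq_right.2 hPlt.le]
      omega
    · rw [Finsupp.sub_apply] at h1
      rw [Finsupp.add_apply, Finsupp.add_apply, Finsupp.single_eq_of_ne hQ]
      linarith
  have hge' : ξ ⊓ D + Finsupp.single P 1 ≤ ξ := by
    intro Q
    rcases eq_or_ne Q P with rfl | hQ
    · simp only [Finsupp.add_apply, Finsupp.inf_apply, Finsupp.single_eq_same,
        inf_eq_right.2 hPlt.le]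
      omega
    · rw [Finsupp.add_apply, Finsupp.single_eq_of_ne hQ, add_zero]
      exact inf_le_left
  have hmem : D + Δ ∈ g := by
    refine hg.mem_of_linEquiv hD (le_trans ?_ hge) ⟨φ, hφ0, fun Q => ?_⟩
    · exact add_nonneg (le_inf hξ hD0) (Finsupp.single_nonneg.2 zero_le_one)
    · rw [Finsupp.add_apply, hΔ]
      ring
  have h1 := (deg_le_deg (le_inf hge' hge)).trans (hmax _ hmem)
  rw [deg_add, deg_single] at h1
  linarith

end Divisor
end SmoothCurve

/-! ### The minimal presentation -/

theorem theorem2p9 {k : Type u} [Field k] [IsAlgClosed k] [CharZero k] (C : SmoothCurve k)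
    (K : C.Divisor) (hK : K.IsCanonical)
    (r : ℕ) (d : ℤ) (g : Set C.Divisor) (hg : SmoothCurve.Divisor.IsCompleteGrd g r d)
    (e : ℤ) (ξ : C.Divisor) (hξ : 0 ≤ ξ) (hξ_h0 : ξ.h0 = 1) (hξ_deg : ξ.deg = e)
    (L : C.Divisor) (hL : L.IsNonspecial)
    (D₀ : C.Divisor) (hD₀ : D₀ ∈ g) (hLK : L.LinEquiv (K - D₀ + ξ))
    (β : ℤ) (hβ : IsGreatest {n : ℤ | ∃ D ∈ g, (ξ ⊓ D).deg = n} β)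
    (hdim : ∀ G : C.Divisor, 0 ≤ G → G.deg ≤ e - β - 1 → (D₀ + G).dimSystem = r)
    (D : C.Divisor) (hD : D ∈ g) (hDβ : (ξ ⊓ D).deg = β) :
    SmoothCurve.Divisor.IsMinimalPresentation K L (D - ξ ⊓ D) (ξ - ξ ⊓ D) ∧
      (D - ξ ⊓ D).deg = d - β ∧
      (ξ - ξ ⊓ D).deg = e - β ∧
      (ξ - ξ ⊓ D).h0 = 1 := by
  have hA : 0 ≤ D - ξ ⊓ D := sub_nonneg.2 inf_le_right
  have hE : 0 ≤ ξ - ξ ⊓ D := sub_nonneg.2 inf_le_left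
  have hmax : ∀ D' ∈ g, (ξ ⊓ D').deg ≤ β := fun D' hD' => hβ.2 ⟨D', hD', rfl⟩
  have hlin : L.LinEquiv (K - (D - ξ ⊓ D) + (ξ - ξ ⊓ D)) :=
    hLK.trans ((hg.linEquiv hD hD₀).of_sub_eq (by abel))
  have hne : ξ - ξ ⊓ D ≠ 0 := by
    intro h
    rw [h, add_zero] at hlin
    exact hL.not_nonneg hK hlin hA
  have hdegE : (ξ - ξ ⊓ D).deg = e - β := by
    rw [SmoothCurve.Divisor.deg_sub, hDβ, hξ_deg]
  refine ⟨⟨⟨hA, ?_, lt_of_le_of_ne hE hne.symm, ?_, hlin⟩, fun B F hBF => ?_⟩, ?_, hdegE, ?_⟩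
  · exact SmoothCurve.Divisor.h0_sub_inf_eq_one hg hξ hD (fun D' hD' => hDβ ▸ hmax D' hD') hne
  · ext P
    simp only [Finsupp.inf_apply, Finsupp.sub_apply, Finsupp.zero_apply]
    omega
  · by_contra hlt
    rw [hdegE, not_le] at hlt
    have hF := hBF.pos.le
    have h0 : (D₀ + F).h0 = D₀.h0 := by
      have h1 := hdim F hF (by omega)
      have h2 := (hg.2 D₀ hD₀).2.1
      rw [SmoothCurve.Divisor.dimSystem] at h1 h2
      omega
    have hpos : D₀.h0 ≠ 0 := by
      have h2 := (hg.2 D₀ hD₀).2.1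
      rw [SmoothCurve.Divisor.dimSystem] at h2
      omega
    have hBξ : (B + ξ).LinEquiv (D₀ + F) :=
      (hLK.symm.trans hBF.linEquiv).of_sub_eq (by abel)
    have hle := SmoothCurve.Divisor.le_of_linEquiv_add hF h0 hpos
      (add_nonneg hBF.effective hξ) hBξ
    have hmem : B + ξ - F ∈ g :=
      hg.mem_of_linEquiv hD₀ (sub_nonneg.2 hle) (hBξ.of_sub_eq (by abel))
    -- F need not be contained in ξ: the inequality holds for arbitrary divisors, and taking degrees
    -- gives e - deg F ≤ β, the contradiction.
    have hinf : ξ - F ≤ ξ ⊓ (B + ξ - F) :=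
      le_inf (sub_le_self _ hF) (by
        rw [add_sub_assoc]
        exact le_add_of_nonneg_left hBF.effective)
    have h1 := (SmoothCurve.Divisor.deg_le_deg hinf).trans (hmax _ hmem)
    rw [SmoothCurve.Divisor.deg_sub, hξ_deg] at h1
    omega
  · rw [SmoothCurve.Divisor.deg_sub, hDβ, (hg.2 D hD).2.2]
  · rw [SmoothCurve.Divisor.h0_eq_one_iff hE]
    exact fun f hf => (SmoothCurve.Divisor.h0_eq_one_iff hξ).1 hξ_h0 f
      (SmoothCurve.Divisor.globalSections_mono
        (sub_le_self _ (le_inf hξ (hg.nonneg hD))) hf)
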